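/- Let $\mathbb H$ be the real quaternion algebra, and let $A\in\mathbb H^{m\times n}$, $B\in\mathbb H^{m\times p_1}$, $C\in\mathbb H^{m\times p_2}$, $D\in\mathbb H^{m\times p_3}$, $E\in\mathbb H^{q_1\times n}$, $F\in\mathbb H^{q_2\times n}$, $G\in\mathbb H^{q_3\times n}$. The rank $r(M)$ of a quaternion matrix is the maximal number of right linearly independent columns of $M$. For a block matrix, $r_{a_{11}\cdots a_{1l}|\cdots|a_{k1}\cdots a_{kl}}$ denotes its rank, a bar separating block rows (for example $r_{bcd}=r(B,C,D)$ and $r_{e|f|g}$ is the rank of $E,F,G$ stacked on top of each other). Put $$t=r_{abcd|e000|f000|g000}-r_{bcd}-r_{e|f|g},$$ $$m_1=r_b+r_c+r_d-r_{db0|d0c},\quad m_2=r_{db0|d0c}-r_{bc}-r_d,\quad m_3=r_{db0|d0c}-r_{bd}-r_c,$$ $$m_4=r_{bc}+r_{cd}+r_{bd}-r_{bcd}-r_{db0|d0c},\quad m_5=r_{bcd}-r_{cd},\quad m_6=r_{db0|d0c}-r_{cd}-r_b,\quad m_7=r_{bcd}-r_{bd},\quad m_8=r_{bcd}-r_{bc},$$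 $$n_1=r_e+r_f+r_g-r_{gg|e0|0f},\quad n_2=r_{gg|e0|0f}-r_{e|f}-r_g,\quad n_3=r_{gg|e0|0f}-r_{e|g}-r_f,$$ $$n_4=r_{e|f}+r_{f|g}+r_{e|g}-r_{e|f|g}-r_{gg|e0|0f},\quad n_5=r_{e|f|g}-r_{f|g},\quad n_6=r_{gg|e0|0f}-r_{f|g}-r_e,\quad n_7=r_{e|f|g}-r_{e|g},\quad n_8=r_{e|f|g}-r_{e|f}.$$ A *simultaneous decomposition* of the seven matrices consists of invertible quaternion matrices $P,Q,T_1,T_2,T_3,V_1,V_2,V_3$ of orders $m,n,p_1,p_2,p_3,q_1,q_2,q_3$ with $$A=PS_AQ,\quad B=PS_BT_1,\quad C=PS_CT_2,\quad D=PS_DT_3,\quad E=V_1S_EQ,\quad F=V_2S_FQ,\quad G=V_3S_GQ,$$ where the following hold. * $S_A=(A_{ij})_{1\le i,j\le 11}$ has block rows of sizes $m_1,m_2,m_3,m_4,m_5,m_4,m_6,m_7,m_8,m-r_{bcd}-t,t$ and block columns of sizes $n_1,n_2,n_3,n_4,n_5,n_4,n_6,n_7,n_8,n-r_{e|f|g}-t,t$.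 Moreover $A_{10,10}=0$, $A_{11,11}=I_t$, and all other blocks in block row $11$ and in block column $11$ are zero. * $S_B,S_C,S_D$ have the same block rows as $S_A$ and block columns of sizes $(m_1,m_2,m_3,m_4,m_5,p_1-r_b)$, $(m_4,m_6,m_7,m_1,m_2,p_2-r_c)$, $(m_8,m_4,m_6,m_3,m_1,p_3-r_d)$, respectively. Their blocks are zero except for identity blocks in the positions $(1,1),(2,2),(3,3),(4,4),(5,5)$ for $S_B$; $(1,4),(2,5),(6,1),(7,2),(8,3)$ for $S_C$; $(1,5),(3,4),(4,2),(6,2),(7,3),(9,1)$ for $S_D$. * $S_E^*,S_F^*,S_G^*$ have the same zero and identity blocks as $S_B,S_C,S_D$, respectively; their block rows have the sizes of the block columns of $S_A$, and their block columns have sizes $(n_1,n_2,n_3,n_4,n_5,q_1-r_e)$, $(n_4,n_6,n_7,n_1,n_2,q_2-r_f)$, $(n_8,n_4,n_6,n_3,n_1,q_3-r_g)$. Then a simultaneous decomposition exists, and for every simultaneous decomposition the following holds. The equation $$BXE+CYF+DZG=A\qquad(\ast)$$ is consistent if and only if $$A_{94}=A_{96},\quad A_{49}=A_{69},\quad A_{64}=A_{46},\quad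 r_{abcd|e000|f000|g000}=r_{bcd}+r_{e|f|g},$$ $$A_{i,10}=0\ (1\le i\le 9),\qquad A_{10,j}=0\ (1\le j\le 9),$$ $$A_{29}=A_{92}=0,\ A_{38}=A_{83}=0,\ A_{48}=A_{84}=0,\ A_{56}=A_{65}=0,$$ $$A_{57}=A_{75}=0,\ A_{58}=A_{85}=0,\ A_{59}=A_{95}=0,\ A_{89}=A_{98}=0.$$ In this case, the general solution of $(\ast)$ is $$X=T_1^{-1}\widehat XV_1^{-1},\qquad Y=T_2^{-1}\widehat YV_2^{-1},\qquad Z=T_3^{-1}\widehat ZV_3^{-1},$$ where $$\widehat X=\begin{pmatrix} X_{11}&X_{12}&X_{13}&X_{14}&A_{15}&X_{16}\\ X_{21}&X_{22}&A_{23}&A_{24}&A_{25}&X_{26}\\ X_{31}&A_{32}&X_{33}&A_{34}-A_{36}&A_{35}&X_{36}\\ X_{41}&A_{42}&A_{43}-A_{63}&A_{44}-A_{64}&A_{45}&X_{46}\\ A_{51}&A_{52}&A_{53}&A_{54}&A_{55}&X_{56}\\ X_{61}&X_{62}&X_{63}&X_{64}&X_{65}&X_{66}\end{pmatrix},$$ $$\widehat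 Y=\begin{pmatrix} A_{66}-A_{64}&A_{67}-A_{47}&A_{68}&A_{61}-A_{41}+X_{41}&A_{62}&Y_{16}\\ A_{76}-A_{74}&Y_{22}&A_{78}&Y_{24}&A_{72}&Y_{26}\\ A_{86}&A_{87}&A_{88}&A_{81}&A_{82}&Y_{36}\\ A_{16}-A_{14}+X_{14}&Y_{42}&A_{18}&Y_{44}&A_{12}-X_{12}&Y_{46}\\ A_{26}&A_{27}&A_{28}&A_{21}-X_{21}&A_{22}-X_{22}&Y_{56}\\ Y_{61}&Y_{62}&Y_{63}&Y_{64}&Y_{65}&Y_{66}\end{pmatrix},$$ $$\widehat Z=\begin{pmatrix} A_{99}&A_{96}&A_{97}&A_{93}&A_{91}&Z_{16}\\ A_{69}&A_{64}&A_{47}&A_{63}&A_{41}-X_{41}&Z_{26}\\ A_{79}&A_{74}&A_{77}-Y_{22}&A_{73}&A_{71}-Y_{24}&Z_{36}\\ A_{39}&A_{36}&A_{37}&A_{33}-X_{33}&A_{31}-X_{31}&Z_{46}\\ A_{19}&A_{14}-X_{14}&A_{17}-Y_{42}&A_{13}-X_{13}&A_{11}-X_{11}-Y_{44}&Z_{56}\\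 Z_{61}&Z_{62}&Z_{63}&Z_{64}&Z_{65}&Z_{66}\end{pmatrix}$$ are partitioned with block rows of the sizes of the block columns of $S_B$, $S_C$, $S_D$ and block columns of the sizes of the block rows of $S_E$, $S_F$, $S_G$, respectively, and the remaining $X_{ij},Y_{ij},Z_{ij}$ are arbitrary quaternion matrices of the appropriate sizes. That is, a triple $(X,Y,Z)$ solves $(\ast)$ if and only if it is of this form for some choice of these matrices. -/

import Mathlib

open scoped Quaternion
open Matrix

/-- The rank of a quaternion matrix: the dimension of the right `ℍ`-vector space spanned by its
columns, i.e. the maximal number of right linearly independent columns. (Right scalar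
multiplication is the action of the opposite ring.) -/
noncomputable def qrank {ι κ : Type} (M : Matrix ι κ ℍ[ℝ]) : ℕ :=
  Module.finrank (ℍ[ℝ])ᵐᵒᵖ
    (Submodule.span (ℍ[ℝ])ᵐᵒᵖ (Set.range fun j : κ => fun i : ι => M i j))

/-- An invertible quaternion matrix `val` with rows labelled by `ι` and columns labelled by `κ`,
together with its two-sided inverse `inv`. (Such a matrix is square: `ι` and `κ` have the same
number of elements.) -/
structure InvMat (ι κ : Type) [Fintype ι] [DecidableEq ι] [Fintype κ] [DecidableEq κ] where
  val : Matrix ι κ ℍ[ℝ]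
  inv : Matrix κ ι ℍ[ℝ]
  val_mul_inv : val * inv = 1
  inv_mul_val : inv * val = 1

/-- The index set of `k` consecutive blocks, labelled `1, …, k`, the `i`-th of size `s i`.
The pair `⟨i, a⟩` with `i : Fin k` is the `a`-th index in the block with label `i + 1`. -/
abbrev BlockIdx (k : ℕ) (s : ℕ → ℕ) : Type := Σ i : Fin k, Fin (s (i.val + 1))

/-- The `k × l` block matrix with the blocks `M i j`, `1 ≤ i ≤ k`, `1 ≤ j ≤ l`. -/
noncomputable def blockMat (k l : ℕ) {r c : ℕ → ℕ} (M : ∀ i j : ℕ, Matrix (Fin (r i)) (Fin (c j)) ℍ[ℝ]) :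
    Matrix (BlockIdx k r) (BlockIdx l c) ℍ[ℝ] :=
  Matrix.of fun x y => M (x.1.val + 1) (y.1.val + 1) x.2 y.2

/-- The `k × l` block matrix with an identity block at every position in `S` and zero blocks
everywhere else. -/
noncomputable def identPattern (k l : ℕ) (r c : ℕ → ℕ) (S : Finset (ℕ × ℕ)) :
    Matrix (BlockIdx k r) (BlockIdx l c) ℍ[ℝ] :=
  Matrix.of fun x y =>
    if (x.1.val + 1, y.1.val + 1) ∈ S ∧ x.2.val = y.2.val then 1 else 0

/-- Positions of the identity blocks in `S_B` (and in `S_E^*`). -/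
def patB : Finset (ℕ × ℕ) := {(1, 1), (2, 2), (3, 3), (4, 4), (5, 5)}

/-- Positions of the identity blocks in `S_C` (and in `S_F^*`). -/
def patC : Finset (ℕ × ℕ) := {(1, 4), (2, 5), (6, 1), (7, 2), (8, 3)}

/-- Positions of the identity blocks in `S_D` (and in `S_G^*`). -/
def patD : Finset (ℕ × ℕ) := {(1, 5), (3, 4), (4, 2), (6, 2), (7, 3), (9, 1)}

/-- Seven quaternion matrices of compatible sizes, forming the array
`(A B C D; E 0 0 0; F 0 0 0; G 0 0 0)`. -/
structure QArray (m n p₁ p₂ p₃ q₁ q₂ q₃ : ℕ) where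
  A : Matrix (Fin m) (Fin n) ℍ[ℝ]
  B : Matrix (Fin m) (Fin p₁) ℍ[ℝ]
  C : Matrix (Fin m) (Fin p₂) ℍ[ℝ]
  D : Matrix (Fin m) (Fin p₃) ℍ[ℝ]
  E : Matrix (Fin q₁) (Fin n) ℍ[ℝ]
  F : Matrix (Fin q₂) (Fin n) ℍ[ℝ]
  G : Matrix (Fin q₃) (Fin n) ℍ[ℝ]

namespace QArray

variable {m n p₁ p₂ p₃ q₁ q₂ q₃ : ℕ}

/-! Ranks of block matrices: a comma separates block columns, a semicolon block rows. -/

/-- The rank of `B`. -/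
noncomputable def rb (K : QArray m n p₁ p₂ p₃ q₁ q₂ q₃) : ℕ := qrank K.B
/-- The rank of `C`. -/
noncomputable def rc (K : QArray m n p₁ p₂ p₃ q₁ q₂ q₃) : ℕ := qrank K.C
/-- The rank of `D`. -/
noncomputable def rd (K : QArray m n p₁ p₂ p₃ q₁ q₂ q₃) : ℕ := qrank K.D
/-- The rank of `(B, C)`. -/
noncomputable def rbc (K : QArray m n p₁ p₂ p₃ q₁ q₂ q₃) : ℕ := qrank (fromCols K.B K.C)
/-- The rank of `(B, D)`. -/
noncomputable def rbd (K : QArray m n p₁ p₂ p₃ q₁ q₂ q₃) : ℕ := qrank (fromCols K.B K.D)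
/-- The rank of `(C, D)`. -/
noncomputable def rcd (K : QArray m n p₁ p₂ p₃ q₁ q₂ q₃) : ℕ := qrank (fromCols K.C K.D)
/-- The rank of `(B, C, D)`. -/
noncomputable def rbcd (K : QArray m n p₁ p₂ p₃ q₁ q₂ q₃) : ℕ :=
  qrank (fromCols K.B (fromCols K.C K.D))
/-- The rank of `(D, B, 0; D, 0, C)`. -/
noncomputable def rdb0_d0c (K : QArray m n p₁ p₂ p₃ q₁ q₂ q₃) : ℕ :=
  qrank (fromRows
    (fromCols K.D (fromCols K.B (0 : Matrix (Fin m) (Fin p₂) ℍ[ℝ])))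
    (fromCols K.D (fromCols (0 : Matrix (Fin m) (Fin p₁) ℍ[ℝ]) K.C)))

/-- The rank of `E`. -/
noncomputable def re (K : QArray m n p₁ p₂ p₃ q₁ q₂ q₃) : ℕ := qrank K.E
/-- The rank of `F`. -/
noncomputable def rf (K : QArray m n p₁ p₂ p₃ q₁ q₂ q₃) : ℕ := qrank K.F
/-- The rank of `G`. -/
noncomputable def rg (K : QArray m n p₁ p₂ p₃ q₁ q₂ q₃) : ℕ := qrank K.G
/-- The rank of `(E; F)`. -/
noncomputable def re_f (K : QArray m n p₁ p₂ p₃ q₁ q₂ q₃) : ℕ := qrank (fromRows K.E K.F)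
/-- The rank of `(E; G)`. -/
noncomputable def re_g (K : QArray m n p₁ p₂ p₃ q₁ q₂ q₃) : ℕ := qrank (fromRows K.E K.G)
/-- The rank of `(F; G)`. -/
noncomputable def rf_g (K : QArray m n p₁ p₂ p₃ q₁ q₂ q₃) : ℕ := qrank (fromRows K.F K.G)
/-- The rank of `(E; F; G)`. -/
noncomputable def re_f_g (K : QArray m n p₁ p₂ p₃ q₁ q₂ q₃) : ℕ :=
  qrank (fromRows K.E (fromRows K.F K.G))
/-- The rank of `(G, G; E, 0; 0, F)`. -/
noncomputable def rgg_e0_0f (K : QArray m n p₁ p₂ p₃ q₁ q₂ q₃) : ℕ :=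
  qrank (fromRows (fromCols K.G K.G) (fromRows
    (fromCols K.E (0 : Matrix (Fin q₁) (Fin n) ℍ[ℝ]))
    (fromCols (0 : Matrix (Fin q₂) (Fin n) ℍ[ℝ]) K.F)))

/-- The rank of the whole array `(A, B, C, D; E, 0, 0, 0; F, 0, 0, 0; G, 0, 0, 0)`. -/
noncomputable def rabcd_e_f_g (K : QArray m n p₁ p₂ p₃ q₁ q₂ q₃) : ℕ :=
  qrank (fromRows (fromCols K.A (fromCols K.B (fromCols K.C K.D)))
    (fromRows (fromCols K.E (0 : Matrix (Fin q₁) (Fin p₁ ⊕ Fin p₂ ⊕ Fin p₃) ℍ[ℝ]))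
      (fromRows (fromCols K.F (0 : Matrix (Fin q₂) (Fin p₁ ⊕ Fin p₂ ⊕ Fin p₃) ℍ[ℝ]))
        (fromCols K.G (0 : Matrix (Fin q₃) (Fin p₁ ⊕ Fin p₂ ⊕ Fin p₃) ℍ[ℝ])))))

/-! Block sizes. All the differences below are non-negative integers (they are dimensions of
subquotients), so that truncated subtraction is ordinary subtraction. -/

/-- The size `t` of the identity block of `S_A`. -/
noncomputable def t (K : QArray m n p₁ p₂ p₃ q₁ q₂ q₃) : ℕ :=
  K.rabcd_e_f_g - (K.rbcd + K.re_f_g)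

/-- The sizes `m₁, …, m₈` (`K.ms i` is `mᵢ`). -/
noncomputable def ms (K : QArray m n p₁ p₂ p₃ q₁ q₂ q₃) : ℕ → ℕ
  | 1 => (K.rb + K.rc + K.rd) - K.rdb0_d0c
  | 2 => K.rdb0_d0c - (K.rbc + K.rd)
  | 3 => K.rdb0_d0c - (K.rbd + K.rc)
  | 4 => (K.rbc + K.rcd + K.rbd) - (K.rbcd + K.rdb0_d0c)
  | 5 => K.rbcd - K.rcd
  | 6 => K.rdb0_d0c - (K.rcd + K.rb)
  | 7 => K.rbcd - K.rbd
  | 8 => K.rbcd - K.rbc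
  | _ => 0

/-- The sizes `n₁, …, n₈` (`K.ns i` is `nᵢ`). -/
noncomputable def ns (K : QArray m n p₁ p₂ p₃ q₁ q₂ q₃) : ℕ → ℕ
  | 1 => (K.re + K.rf + K.rg) - K.rgg_e0_0f
  | 2 => K.rgg_e0_0f - (K.re_f + K.rg)
  | 3 => K.rgg_e0_0f - (K.re_g + K.rf)
  | 4 => (K.re_f + K.rf_g + K.re_g) - (K.re_f_g + K.rgg_e0_0f)
  | 5 => K.re_f_g - K.rf_g
  | 6 => K.rgg_e0_0f - (K.rf_g + K.re)
  | 7 => K.re_f_g - K.re_g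
  | 8 => K.re_f_g - K.re_f
  | _ => 0

/-- The sizes of the eleven block rows of `S_A`. -/
noncomputable def rowSize (K : QArray m n p₁ p₂ p₃ q₁ q₂ q₃) : ℕ → ℕ
  | 1 => K.ms 1
  | 2 => K.ms 2
  | 3 => K.ms 3
  | 4 => K.ms 4
  | 5 => K.ms 5
  | 6 => K.ms 4
  | 7 => K.ms 6
  | 8 => K.ms 7
  | 9 => K.ms 8
  | 10 => m - (K.rbcd + K.t)
  | 11 => K.t
  | _ => 0

/-- The sizes of the eleven block columns of `S_A`. -/
noncomputable def colSize (K : QArray m n p₁ p₂ p₃ q₁ q₂ q₃) : ℕ → ℕ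
  | 1 => K.ns 1
  | 2 => K.ns 2
  | 3 => K.ns 3
  | 4 => K.ns 4
  | 5 => K.ns 5
  | 6 => K.ns 4
  | 7 => K.ns 6
  | 8 => K.ns 7
  | 9 => K.ns 8
  | 10 => n - (K.re_f_g + K.t)
  | 11 => K.t
  | _ => 0

/-- The sizes of the block columns of `S_B`, which are those of the block rows of `X̂`. -/
noncomputable def xRow (K : QArray m n p₁ p₂ p₃ q₁ q₂ q₃) : ℕ → ℕ
  | 1 => K.ms 1
  | 2 => K.ms 2
  | 3 => K.ms 3
  | 4 => K.ms 4
  | 5 => K.ms 5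
  | 6 => p₁ - K.rb
  | _ => 0

/-- The sizes of the block columns of `S_C`, which are those of the block rows of `Ŷ`. -/
noncomputable def yRow (K : QArray m n p₁ p₂ p₃ q₁ q₂ q₃) : ℕ → ℕ
  | 1 => K.ms 4
  | 2 => K.ms 6
  | 3 => K.ms 7
  | 4 => K.ms 1
  | 5 => K.ms 2
  | 6 => p₂ - K.rc
  | _ => 0

/-- The sizes of the block columns of `S_D`, which are those of the block rows of `Ẑ`. -/
noncomputable def zRow (K : QArray m n p₁ p₂ p₃ q₁ q₂ q₃) : ℕ → ℕ
  | 1 => K.ms 8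
  | 2 => K.ms 4
  | 3 => K.ms 6
  | 4 => K.ms 3
  | 5 => K.ms 1
  | 6 => p₃ - K.rd
  | _ => 0

/-- The sizes of the block rows of `S_E`, which are those of the block columns of `X̂`. -/
noncomputable def xCol (K : QArray m n p₁ p₂ p₃ q₁ q₂ q₃) : ℕ → ℕ
  | 1 => K.ns 1
  | 2 => K.ns 2
  | 3 => K.ns 3
  | 4 => K.ns 4
  | 5 => K.ns 5
  | 6 => q₁ - K.re
  | _ => 0

/-- The sizes of the block rows of `S_F`, which are those of the block columns of `Ŷ`. -/
noncomputable def yCol (K : QArray m n p₁ p₂ p₃ q₁ q₂ q₃) : ℕ → ℕ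
  | 1 => K.ns 4
  | 2 => K.ns 6
  | 3 => K.ns 7
  | 4 => K.ns 1
  | 5 => K.ns 2
  | 6 => q₂ - K.rf
  | _ => 0

/-- The sizes of the block rows of `S_G`, which are those of the block columns of `Ẑ`. -/
noncomputable def zCol (K : QArray m n p₁ p₂ p₃ q₁ q₂ q₃) : ℕ → ℕ
  | 1 => K.ns 8
  | 2 => K.ns 4
  | 3 => K.ns 6
  | 4 => K.ns 3
  | 5 => K.ns 1
  | 6 => q₃ - K.rg
  | _ => 0

/-- A simultaneous decomposition of the array: `A = P S_A Q`, `B = P S_B T₁`, `C = P S_C T₂`,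
`D = P S_D T₃`, `E = V₁ S_E Q`, `F = V₂ S_F Q`, `G = V₃ S_G Q` with invertible
`P, Q, T₁, T₂, T₃, V₁, V₂, V₃`. Here `S_A` is the `11 × 11` block matrix with the blocks
`A_{ij} = blk i j`, where `A_{10,10} = 0`, `A_{11,11} = I_t` and the other blocks in the last block
row and in the last block column vanish. -/
structure Decomposition (K : QArray m n p₁ p₂ p₃ q₁ q₂ q₃) where
  P : InvMat (Fin m) (BlockIdx 11 K.rowSize)
  Q : InvMat (BlockIdx 11 K.colSize) (Fin n)
  T₁ : InvMat (BlockIdx 6 K.xRow) (Fin p₁)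
  T₂ : InvMat (BlockIdx 6 K.yRow) (Fin p₂)
  T₃ : InvMat (BlockIdx 6 K.zRow) (Fin p₃)
  V₁ : InvMat (Fin q₁) (BlockIdx 6 K.xCol)
  V₂ : InvMat (Fin q₂) (BlockIdx 6 K.yCol)
  V₃ : InvMat (Fin q₃) (BlockIdx 6 K.zCol)
  blk : ∀ i j : ℕ, Matrix (Fin (K.rowSize i)) (Fin (K.colSize j)) ℍ[ℝ]
  blk_ten_ten : blk 10 10 = 0
  blk_last : blk 11 11 = (1 : Matrix (Fin K.t) (Fin K.t) ℍ[ℝ])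
  blk_last_col : ∀ i, i ≠ 11 → blk i 11 = 0
  blk_last_row : ∀ j, j ≠ 11 → blk 11 j = 0
  hA : K.A = P.val * blockMat 11 11 blk * Q.val
  hB : K.B = P.val * identPattern 11 6 K.rowSize K.xRow patB * T₁.val
  hC : K.C = P.val * identPattern 11 6 K.rowSize K.yRow patC * T₂.val
  hD : K.D = P.val * identPattern 11 6 K.rowSize K.zRow patD * T₃.val
  hE : K.E = V₁.val * (identPattern 11 6 K.colSize K.xCol patB)ᴴ * Q.val
  hF : K.F = V₂.val * (identPattern 11 6 K.colSize K.yCol patC)ᴴ * Q.val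
  hG : K.G = V₃.val * (identPattern 11 6 K.colSize K.zCol patD)ᴴ * Q.val

/-- Families of blocks `X_{ij}` of the sizes of the blocks of `X̂`. -/
abbrev XBlocks (K : QArray m n p₁ p₂ p₃ q₁ q₂ q₃) : Type :=
  ∀ i j : ℕ, Matrix (Fin (K.xRow i)) (Fin (K.xCol j)) ℍ[ℝ]

/-- Families of blocks `Y_{ij}` of the sizes of the blocks of `Ŷ`. -/
abbrev YBlocks (K : QArray m n p₁ p₂ p₃ q₁ q₂ q₃) : Type :=
  ∀ i j : ℕ, Matrix (Fin (K.yRow i)) (Fin (K.yCol j)) ℍ[ℝ]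

/-- Families of blocks `Z_{ij}` of the sizes of the blocks of `Ẑ`. -/
abbrev ZBlocks (K : QArray m n p₁ p₂ p₃ q₁ q₂ q₃) : Type :=
  ∀ i j : ℕ, Matrix (Fin (K.zRow i)) (Fin (K.zCol j)) ℍ[ℝ]

namespace Decomposition

variable {K : QArray m n p₁ p₂ p₃ q₁ q₂ q₃}

/-- The sum of two blocks. The sizes of the two blocks are recorded by different expressions that
reduce to the same numbers, which is why the size is taken from the expected type. -/
noncomputable abbrev badd {a b : ℕ} (M N : Matrix (Fin a) (Fin b) ℍ[ℝ]) :
    Matrix (Fin a) (Fin b) ℍ[ℝ] := M + N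

/-- The difference of two blocks; see `badd`. -/
noncomputable abbrev bsub {a b : ℕ} (M N : Matrix (Fin a) (Fin b) ℍ[ℝ]) :
    Matrix (Fin a) (Fin b) ℍ[ℝ] := M - N

/-- The blocks of `X̂`; those not listed are the free parameters `X_{ij}`. -/
noncomputable def xHat (d : K.Decomposition) (X : K.XBlocks) : K.XBlocks
  | 1, 5 => d.blk 1 5
  | 2, 3 => d.blk 2 3
  | 2, 4 => d.blk 2 4
  | 2, 5 => d.blk 2 5
  | 3, 2 => d.blk 3 2
  | 3, 4 => bsub (d.blk 3 4) (d.blk 3 6)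
  | 3, 5 => d.blk 3 5
  | 4, 2 => d.blk 4 2
  | 4, 3 => bsub (d.blk 4 3) (d.blk 6 3)
  | 4, 4 => bsub (d.blk 4 4) (d.blk 6 4)
  | 4, 5 => d.blk 4 5
  | 5, 1 => d.blk 5 1
  | 5, 2 => d.blk 5 2
  | 5, 3 => d.blk 5 3
  | 5, 4 => d.blk 5 4
  | 5, 5 => d.blk 5 5
  | i, j => X i j

/-- The blocks of `Ŷ`; those not listed are the free parameters `Y_{ij}`. -/
noncomputable def yHat (d : K.Decomposition) (X : K.XBlocks) (Y : K.YBlocks) : K.YBlocks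
  | 1, 1 => bsub (d.blk 6 6) (d.blk 6 4)
  | 1, 2 => bsub (d.blk 6 7) (d.blk 4 7)
  | 1, 3 => d.blk 6 8
  | 1, 4 => badd (bsub (d.blk 6 1) (d.blk 4 1)) (X 4 1)
  | 1, 5 => d.blk 6 2
  | 2, 1 => bsub (d.blk 7 6) (d.blk 7 4)
  | 2, 3 => d.blk 7 8
  | 2, 5 => d.blk 7 2
  | 3, 1 => d.blk 8 6
  | 3, 2 => d.blk 8 7
  | 3, 3 => d.blk 8 8
  | 3, 4 => d.blk 8 1
  | 3, 5 => d.blk 8 2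
  | 4, 1 => badd (bsub (d.blk 1 6) (d.blk 1 4)) (X 1 4)
  | 4, 3 => d.blk 1 8
  | 4, 5 => bsub (d.blk 1 2) (X 1 2)
  | 5, 1 => d.blk 2 6
  | 5, 2 => d.blk 2 7
  | 5, 3 => d.blk 2 8
  | 5, 4 => bsub (d.blk 2 1) (X 2 1)
  | 5, 5 => bsub (d.blk 2 2) (X 2 2)
  | i, j => Y i j

/-- The blocks of `Ẑ`; those not listed are the free parameters `Z_{ij}`. -/
noncomputable def zHat (d : K.Decomposition) (X : K.XBlocks) (Y : K.YBlocks) (Z : K.ZBlocks) : K.ZBlocks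
  | 1, 1 => d.blk 9 9
  | 1, 2 => d.blk 9 6
  | 1, 3 => d.blk 9 7
  | 1, 4 => d.blk 9 3
  | 1, 5 => d.blk 9 1
  | 2, 1 => d.blk 6 9
  | 2, 2 => d.blk 6 4
  | 2, 3 => d.blk 4 7
  | 2, 4 => d.blk 6 3
  | 2, 5 => bsub (d.blk 4 1) (X 4 1)
  | 3, 1 => d.blk 7 9
  | 3, 2 => d.blk 7 4
  | 3, 3 => bsub (d.blk 7 7) (Y 2 2)
  | 3, 4 => d.blk 7 3
  | 3, 5 => bsub (d.blk 7 1) (Y 2 4)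
  | 4, 1 => d.blk 3 9
  | 4, 2 => d.blk 3 6
  | 4, 3 => d.blk 3 7
  | 4, 4 => bsub (d.blk 3 3) (X 3 3)
  | 4, 5 => bsub (d.blk 3 1) (X 3 1)
  | 5, 1 => d.blk 1 9
  | 5, 2 => bsub (d.blk 1 4) (X 1 4)
  | 5, 3 => bsub (d.blk 1 7) (Y 4 2)
  | 5, 4 => bsub (d.blk 1 3) (X 1 3)
  | 5, 5 => bsub (bsub (d.blk 1 1) (X 1 1)) (Y 4 4)
  | i, j => Z i j

end Decomposition

/-- `(X, Y, Z)` solves `B X E + C Y F + D Z G = A`. -/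
def IsSolution (K : QArray m n p₁ p₂ p₃ q₁ q₂ q₃) (X : Matrix (Fin p₁) (Fin q₁) ℍ[ℝ])
    (Y : Matrix (Fin p₂) (Fin q₂) ℍ[ℝ]) (Z : Matrix (Fin p₃) (Fin q₃) ℍ[ℝ]) : Prop :=
  K.B * X * K.E + K.C * Y * K.F + K.D * Z * K.G = K.A

end QArray

/-! ### Right linear algebra over the quaternions -/

section RightLinearAlgebra

open Module

variable {ι κ μ : Type}

/-! Granted the decomposition, the equation is elementary. Cancelling the invertible factors leaves
`S_B X̂ S_E + S_C Ŷ S_F + S_D Ẑ S_G = S_A` with `X̂ = T₁ X V₁`, and similarly for `Y` and `Z`. The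
patterns contain only zero and identity blocks, so each of the 121 blocks on the left is a sum of at
most one block from each of `X̂`, `Ŷ`, `Ẑ`. Where the left side is zero, a block of `S_A` must
vanish. Where the same block of `Ẑ` stands alone twice, because `S_D` repeats block column 2 in
block rows 4 and 6, two blocks of `S_A` must agree. The block `I_t` must vanish, which is the rank
condition. The other equations determine blocks or express one block through free ones
(`SolvesBlocks.solvable`, `Solvable.solvesBlocks`).

Existence of the decomposition is the classification of three subspaces `U₁, U₂, U₃`, here the right
column spaces of `B`, `C`, `D`. Each triple is a direct sum of indecomposables of nine types. Eight
of these have a one-dimensional ambient space; the ninth is a plane with the three lines spanned by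
`v₄`, `v₆` and `v₄ + v₆`, which is why `m₄` occurs twice among the block rows. The multiplicities
follow from the ranks of the sums and from the dimension of the triple intersection, which
`qrank_triple_add_finrank_inf` extracts from the rank of `(D, B, 0; D, 0, C)`. Adapted bases come
from `TripleDims.exists_families` and become the matrices of `exists_triple_form`. The same result
for `Eᴴ`, `Fᴴ`, `Gᴴ` treats the columns.

What is left of `A` is its corner complementary to the column space of `(B, C, D)` and to the row
space of `(E; F; G)`. By `qrank_bordered` the rank of this corner is `t`. `exists_corner_reduction`
brings it to rank normal form and clears the last block row and column by triangular matrices that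
leave the six patterns unchanged. -/

instance finite_mulOpposite_quaternion : Module.Finite (ℍ[ℝ])ᵐᵒᵖ ℍ[ℝ] :=
  Module.Finite.of_surjective (LinearMap.toSpanSingleton (ℍ[ℝ])ᵐᵒᵖ ℍ[ℝ] 1) fun x =>
    ⟨MulOpposite.op x, by simp⟩

theorem finrank_mulOpposite_quaternion : finrank (ℍ[ℝ])ᵐᵒᵖ ℍ[ℝ] = 1 :=
  finrank_eq_one (1 : ℍ[ℝ]) one_ne_zero fun w => ⟨MulOpposite.op w, by simp⟩

theorem finrank_quaternion_fun [Fintype ι] :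
    finrank (ℍ[ℝ])ᵐᵒᵖ (ι → ℍ[ℝ]) = Fintype.card ι := by
  rw [Module.finrank_pi_fintype]
  simp [finrank_mulOpposite_quaternion]

/-- The right span of the columns of a quaternion matrix. -/
noncomputable def colSpan (M : Matrix ι κ ℍ[ℝ]) : Submodule (ℍ[ℝ])ᵐᵒᵖ (ι → ℍ[ℝ]) :=
  Submodule.span (ℍ[ℝ])ᵐᵒᵖ (Set.range fun j : κ => fun i : ι => M i j)

theorem qrank_eq_finrank (M : Matrix ι κ ℍ[ℝ]) : qrank M = finrank (ℍ[ℝ])ᵐᵒᵖ (colSpan M) := rfl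

/-- Left multiplication by a matrix as a right linear map. -/
noncomputable def mulVecRight [Fintype κ] (M : Matrix ι κ ℍ[ℝ]) :
    (κ → ℍ[ℝ]) →ₗ[(ℍ[ℝ])ᵐᵒᵖ] (ι → ℍ[ℝ]) where
  toFun x := M *ᵥ x
  map_add' := Matrix.mulVec_add M
  map_smul' := Matrix.mulVec_smul M

@[simp] theorem mulVecRight_apply [Fintype κ] (M : Matrix ι κ ℍ[ℝ]) (x : κ → ℍ[ℝ]) :
    mulVecRight M x = M *ᵥ x := rfl

/-- The entries of the vector multiply those of `M` from the right, so images are right linear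
combinations of columns. This is the reason for scalars in the opposite ring. -/
theorem mulVec_eq_sum_op_smul [Fintype κ] (M : Matrix ι κ ℍ[ℝ]) (x : κ → ℍ[ℝ]) :
    M *ᵥ x = ∑ j, MulOpposite.op (x j) • fun i => M i j := by
  ext i <;> simp [Matrix.mulVec, dotProduct, Finset.sum_apply]

theorem range_mulVecRight [Fintype κ] (M : Matrix ι κ ℍ[ℝ]) :
    LinearMap.range (mulVecRight M) = colSpan M := by
  classical
  apply le_antisymm
  · rintro _ ⟨x, rfl⟩
    rw [mulVecRight_apply, mulVec_eq_sum_op_smul]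
    exact Submodule.sum_mem _ fun j _ => Submodule.smul_mem _ _ (Submodule.subset_span ⟨j, rfl⟩)
  · refine Submodule.span_le.2 ?_
    rintro _ ⟨j, rfl⟩
    refine ⟨Pi.single j 1, ?_⟩
    ext1 i
    simp

theorem colSpan_mul [Fintype κ] (M : Matrix ι κ ℍ[ℝ]) (N : Matrix κ μ ℍ[ℝ]) :
    colSpan (M * N) = (colSpan N).map (mulVecRight M) := by
  rw [colSpan, colSpan, Submodule.map_span, ← Set.range_comp]
  rfl

theorem colSpan_mul_le [Fintype κ] (M : Matrix ι κ ℍ[ℝ]) (N : Matrix κ μ ℍ[ℝ]) :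
    colSpan (M * N) ≤ colSpan M := by
  rw [colSpan_mul, ← range_mulVecRight M]
  exact LinearMap.map_le_range

theorem qrank_mul_le_left [Fintype ι] [Fintype κ] (M : Matrix ι κ ℍ[ℝ]) (N : Matrix κ μ ℍ[ℝ]) :
    qrank (M * N) ≤ qrank M :=
  Submodule.finrank_mono (colSpan_mul_le M N)

theorem qrank_mul_le_right [Fintype κ] (M : Matrix ι κ ℍ[ℝ]) (N : Matrix κ μ ℍ[ℝ]) :
    qrank (M * N) ≤ qrank N := by
  rw [qrank_eq_finrank, colSpan_mul]
  exact Submodule.finrank_map_le _ _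

theorem qrank_le_card [Fintype κ] (M : Matrix ι κ ℍ[ℝ]) : qrank M ≤ Fintype.card κ :=
  finrank_range_le_card _

theorem exists_eq_mul_of_colSpan_le [Fintype κ] {M : Matrix ι κ ℍ[ℝ]} {N : Matrix ι μ ℍ[ℝ]}
    (h : colSpan N ≤ colSpan M) : ∃ X : Matrix κ μ ℍ[ℝ], N = M * X := by
  have : ∀ j, ∃ x, mulVecRight M x = fun i => N i j := fun j => by
    have := h (Submodule.subset_span ⟨j, rfl⟩)
    rwa [← range_mulVecRight] at this
  choose x hx using this
  refine ⟨Matrix.of fun k j => x j k, ?_⟩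
  ext1 i j
  exact (congrFun (hx j) i).symm

theorem exists_rank_factorization [Fintype ι] (M : Matrix ι κ ℍ[ℝ]) {t : ℕ} (ht : qrank M = t) :
    ∃ (U : Matrix ι (Fin t) ℍ[ℝ]) (W : Matrix (Fin t) κ ℍ[ℝ]), M = U * W := by
  subst ht
  let b := Module.finBasis (ℍ[ℝ])ᵐᵒᵖ (colSpan M)
  let U : Matrix ι (Fin (qrank M)) ℍ[ℝ] := Matrix.of fun i k => (b k : ι → ℍ[ℝ]) i
  refine ⟨U, exists_eq_mul_of_colSpan_le fun x hx => ?_⟩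
  have h : (x : ι → ℍ[ℝ]) = ∑ k, b.repr ⟨x, hx⟩ k • (b k : ι → ℍ[ℝ]) := by
    have := congrArg (colSpan M).subtype (b.sum_repr ⟨x, hx⟩)
    rw [map_sum] at this
    exact this.symm
  rw [h]
  exact Submodule.sum_mem _ fun k _ => Submodule.smul_mem _ _ (Submodule.subset_span ⟨k, rfl⟩)

/-- With `M = U * W` through `Fin (qrank M)`, the columns of `Mᴴ = Wᴴ * Uᴴ` lie in the span of the
`qrank M` columns of `Wᴴ`. The conjugation is essential: over a noncommutative ring the plain
transpose does not reverse products. -/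
theorem qrank_conjTranspose_le [Fintype ι] [Fintype κ] (M : Matrix ι κ ℍ[ℝ]) :
    qrank Mᴴ ≤ qrank M := by
  obtain ⟨U, W, h⟩ := exists_rank_factorization M rfl
  calc qrank Mᴴ = qrank (Wᴴ * Uᴴ) := by rw [← conjTranspose_mul, ← h]
    _ ≤ qrank Wᴴ := qrank_mul_le_left _ _
    _ ≤ qrank M := by simpa using qrank_le_card Wᴴ

theorem qrank_conjTranspose [Fintype ι] [Fintype κ] (M : Matrix ι κ ℍ[ℝ]) :
    qrank Mᴴ = qrank M :=
  le_antisymm (qrank_conjTranspose_le M) (by simpa using qrank_conjTranspose_le Mᴴ)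

/-- Mutual divisibility suffices and no factor has to be invertible, so the two matrices may have
different sizes. -/
theorem qrank_eq_of_mul_eq [Fintype ι] [Fintype κ] {ι' κ' : Type} [Fintype ι'] [Fintype κ']
    {M : Matrix ι κ ℍ[ℝ]} {N : Matrix ι' κ' ℍ[ℝ]}
    (X : Matrix ι ι' ℍ[ℝ]) (Y : Matrix κ' κ ℍ[ℝ]) (X' : Matrix ι' ι ℍ[ℝ]) (Y' : Matrix κ κ' ℍ[ℝ])
    (h : M = X * N * Y) (h' : N = X' * M * Y') : qrank M = qrank N := by
  apply le_antisymm
  · rw [h]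
    exact (qrank_mul_le_left _ _).trans (qrank_mul_le_right _ _)
  · rw [h']
    exact (qrank_mul_le_left _ _).trans (qrank_mul_le_right _ _)

theorem colSpan_one [DecidableEq ι] [Fintype ι] : colSpan (1 : Matrix ι ι ℍ[ℝ]) = ⊤ := by
  rw [← range_mulVecRight, LinearMap.range_eq_top]
  exact fun x => ⟨x, by simp⟩

theorem qrank_one [DecidableEq ι] [Fintype ι] :
    qrank (1 : Matrix ι ι ℍ[ℝ]) = Fintype.card ι := by
  rw [qrank_eq_finrank, colSpan_one, finrank_top, finrank_quaternion_fun]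

theorem colSpan_fromCols (M : Matrix ι κ ℍ[ℝ]) (N : Matrix ι μ ℍ[ℝ]) :
    colSpan (fromCols M N) = colSpan M ⊔ colSpan N := by
  rw [colSpan, colSpan, colSpan, ← Submodule.span_union]
  congr 1
  ext x
  simp only [Set.mem_range, Set.mem_union, Sum.exists]
  rfl

theorem qrank_submatrix_le {ι' κ' : Type} [Fintype ι] [Fintype κ] [Fintype ι'] [Fintype κ']
    (M : Matrix ι κ ℍ[ℝ]) (e : ι' → ι) (f : κ' → κ) :
    qrank (M.submatrix e f) ≤ qrank M := by
  classical
  have h : M.submatrix e f =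
      (1 : Matrix ι ι ℍ[ℝ]).submatrix e id * M * (1 : Matrix κ κ ℍ[ℝ]).submatrix id f := by
    ext1 i j
    simp [Matrix.mul_apply, Matrix.one_apply]
  rw [h]
  exact (qrank_mul_le_left _ _).trans (qrank_mul_le_right _ _)

theorem qrank_submatrix_equiv {ι' κ' : Type} [Fintype ι] [Fintype κ] [Fintype ι'] [Fintype κ']
    (M : Matrix ι κ ℍ[ℝ]) (e : ι' ≃ ι) (f : κ' ≃ κ) :
    qrank (M.submatrix e f) = qrank M :=
  le_antisymm (qrank_submatrix_le M e f)
    (by simpa using qrank_submatrix_le (M.submatrix e f) e.symm f.symm)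

/-- Extension by zero of a column vector to the upper half of a block column. -/
noncomputable def extendUpper (ι κ : Type) :
    (ι → ℍ[ℝ]) →ₗ[(ℍ[ℝ])ᵐᵒᵖ] (ι ⊕ κ → ℍ[ℝ]) where
  toFun x := Sum.elim x 0
  map_add' x y := by ext1 (i | i) <;> simp
  map_smul' x y := by ext1 (i | i) <;> simp

/-- Extension by zero of a column vector to the lower half of a block column. -/
noncomputable def extendLower (ι κ : Type) :
    (κ → ℍ[ℝ]) →ₗ[(ℍ[ℝ])ᵐᵒᵖ] (ι ⊕ κ → ℍ[ℝ]) where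
  toFun x := Sum.elim 0 x
  map_add' x y := by ext1 (i | i) <;> simp
  map_smul' x y := by ext1 (i | i) <;> simp

@[simp] theorem extendUpper_apply (x : ι → ℍ[ℝ]) :
    extendUpper ι κ x = Sum.elim x (0 : κ → ℍ[ℝ]) := rfl

@[simp] theorem extendLower_apply (x : κ → ℍ[ℝ]) :
    extendLower ι κ x = Sum.elim (0 : ι → ℍ[ℝ]) x := rfl

theorem extendUpper_injective : Function.Injective (extendUpper ι κ) := fun x y h => by
  ext1 i
  simpa using congrFun h (Sum.inl i)

theorem extendLower_injective : Function.Injective (extendLower ι κ) := fun x y h => by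
  ext1 i
  simpa using congrFun h (Sum.inr i)

theorem colSpan_fromRows_zero (M : Matrix ι μ ℍ[ℝ]) :
    colSpan (fromRows M (0 : Matrix κ μ ℍ[ℝ])) = (colSpan M).map (extendUpper ι κ) := by
  rw [colSpan, colSpan, Submodule.map_span, ← Set.range_comp]
  congr 2
  ext1 j
  ext1 (i | i) <;> rfl

theorem colSpan_zero_fromRows (M : Matrix κ μ ℍ[ℝ]) :
    colSpan (fromRows (0 : Matrix ι μ ℍ[ℝ]) M) = (colSpan M).map (extendLower ι κ) := by
  rw [colSpan, colSpan, Submodule.map_span, ← Set.range_comp]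
  congr 2
  ext1 j
  ext1 (i | i) <;> rfl

theorem finrank_map_extendUpper_sup_map_extendLower [Finite ι] [Finite κ]
    (S : Submodule (ℍ[ℝ])ᵐᵒᵖ (ι → ℍ[ℝ])) (T : Submodule (ℍ[ℝ])ᵐᵒᵖ (κ → ℍ[ℝ])) :
    finrank (ℍ[ℝ])ᵐᵒᵖ ↥(S.map (extendUpper ι κ) ⊔ T.map (extendLower ι κ)) =
      finrank (ℍ[ℝ])ᵐᵒᵖ S + finrank (ℍ[ℝ])ᵐᵒᵖ T := by
  have h := Submodule.finrank_sup_add_finrank_inf_eq (S.map (extendUpper ι κ))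
    (T.map (extendLower ι κ))
  have h0 : S.map (extendUpper ι κ) ⊓ T.map (extendLower ι κ) = ⊥ := by
    rw [eq_bot_iff]
    rintro _ ⟨⟨x, -, rfl⟩, y, -, hy⟩
    rw [Submodule.mem_bot]
    have hx : x = 0 := by
      ext1 i
      simpa using (congrFun hy (Sum.inl i)).symm
    rw [hx, map_zero]
  rw [h0, finrank_bot, add_zero] at h
  rw [h, ← (Submodule.equivMapOfInjective _ extendUpper_injective S).finrank_eq,
    ← (Submodule.equivMapOfInjective _ extendLower_injective T).finrank_eq]

theorem qrank_fromBlocks_diagonal [Fintype ι] [Fintype κ] {μ ν : Type}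
    (M : Matrix ι μ ℍ[ℝ]) (N : Matrix κ ν ℍ[ℝ]) :
    qrank (fromBlocks M 0 0 N) = qrank M + qrank N := by
  rw [← Matrix.fromCols_fromRows_eq_fromBlocks, qrank_eq_finrank, colSpan_fromCols, colSpan_fromRows_zero,
    colSpan_zero_fromRows, finrank_map_extendUpper_sup_map_extendLower]
  rfl

end RightLinearAlgebra

/-! ### Invertible matrices -/

namespace InvMat

variable {ι κ μ ν : Type} [Fintype ι] [DecidableEq ι] [Fintype κ] [DecidableEq κ]
  [Fintype μ] [DecidableEq μ] [Fintype ν] [DecidableEq ν]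

/-- The invertible matrix whose columns are the members of a basis. -/
noncomputable def ofBasis (b : Module.Basis κ (ℍ[ℝ])ᵐᵒᵖ (ι → ℍ[ℝ])) : InvMat ι κ where
  val := Matrix.of fun i k => b k i
  inv := Matrix.of fun k i => (b.repr (Pi.single i 1) k).unop
  val_mul_inv := by
    ext1 i j
    have h := congrFun (b.sum_repr (Pi.single j 1)) i
    simpa [Matrix.mul_apply, Matrix.one_apply, Pi.single_apply, Finset.sum_apply] using h
  inv_mul_val := by
    ext1 k l
    have h : b l = ∑ i, MulOpposite.op (b l i) • (Pi.single i 1 : ι → ℍ[ℝ]) := by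
      ext1 i
      simp [Finset.sum_apply, Pi.single_apply]
    have h2 : b.repr (b l) k =
        ∑ i, MulOpposite.op (b l i) * b.repr (Pi.single i 1 : ι → ℍ[ℝ]) k := by
      conv_lhs => rw [h]
      simp [Finsupp.finsetSum_apply]
    -- Passing out of the opposite ring reverses each product into the order required by the matrix
    -- product `inv * val`.
    have h3 := congrArg MulOpposite.unop h2
    rw [b.repr_self, Finsupp.single_apply] at h3
    simp only [Matrix.mul_apply, Matrix.of_apply, Matrix.one_apply]
    simp only [Finset.unop_sum, MulOpposite.unop_mul, MulOpposite.unop_op] at h3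
    rw [← h3]
    by_cases hkl : k = l
    · simp [hkl]
    · simp [hkl, Ne.symm hkl]

@[simp] theorem ofBasis_val_apply (b : Module.Basis κ (ℍ[ℝ])ᵐᵒᵖ (ι → ℍ[ℝ])) (i : ι) (k : κ) :
    (ofBasis b).val i k = b k i := rfl

/-- The inverse of an invertible matrix. -/
def symm (M : InvMat ι κ) : InvMat κ ι := ⟨M.inv, M.val, M.inv_mul_val, M.val_mul_inv⟩

/-- The product of invertible matrices. -/
noncomputable def mul (M : InvMat ι κ) (N : InvMat κ μ) : InvMat ι μ where
  val := M.val * N.val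
  inv := N.inv * M.inv
  val_mul_inv := by
    rw [Matrix.mul_assoc, ← Matrix.mul_assoc N.val, N.val_mul_inv, Matrix.one_mul, M.val_mul_inv]
  inv_mul_val := by
    rw [Matrix.mul_assoc, ← Matrix.mul_assoc M.inv, M.inv_mul_val, Matrix.one_mul, N.inv_mul_val]

/-- The conjugate transpose of an invertible matrix. -/
noncomputable def conjTranspose (M : InvMat ι κ) : InvMat κ ι where
  val := M.valᴴ
  inv := M.invᴴ
  val_mul_inv := by rw [← Matrix.conjTranspose_mul, M.inv_mul_val, Matrix.conjTranspose_one]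
  inv_mul_val := by rw [← Matrix.conjTranspose_mul, M.val_mul_inv, Matrix.conjTranspose_one]

/-- Relabelling of the rows and columns of an invertible matrix. -/
noncomputable def reindex (M : InvMat ι κ) (e : μ ≃ ι) (f : ν ≃ κ) : InvMat μ ν where
  val := M.val.submatrix e f
  inv := M.inv.submatrix f e
  val_mul_inv := by rw [Matrix.submatrix_mul_equiv, M.val_mul_inv, Matrix.submatrix_one_equiv]
  inv_mul_val := by rw [Matrix.submatrix_mul_equiv, M.inv_mul_val, Matrix.submatrix_one_equiv]

theorem reindex_val (M : InvMat ι κ) (e : μ ≃ ι) (f : ν ≃ κ) :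
    (M.reindex e f).val = M.val.submatrix e f := rfl

theorem reindex_mul_submatrix_mul_reindex {ι' μ' : Type} [Fintype ι'] [DecidableEq ι']
    [Fintype μ'] [DecidableEq μ'] (L : InvMat ι κ) (R : InvMat μ ν) (S : Matrix κ μ ℍ[ℝ])
    (e : ι' ≃ κ) (f : μ' ≃ μ) :
    (L.reindex (Equiv.refl _) e).val * S.submatrix e f * (R.reindex f (Equiv.refl _)).val =
      L.val * S * R.val := by
  rw [reindex_val, reindex_val, Matrix.submatrix_mul_equiv, Matrix.submatrix_mul_equiv]
  rfl

/-- The block diagonal matrix with an identity block and a given invertible block. -/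
noncomputable def oneDiag (κ : Type) [Fintype κ] [DecidableEq κ] (M : InvMat μ ν) :
    InvMat (κ ⊕ μ) (κ ⊕ ν) where
  val := fromBlocks 1 0 0 M.val
  inv := fromBlocks 1 0 0 M.inv
  val_mul_inv := by simp [fromBlocks_multiply, M.val_mul_inv]
  inv_mul_val := by simp [fromBlocks_multiply, M.inv_mul_val]

/-- The upper unitriangular block matrix with a given off-diagonal block. -/
noncomputable def upper (N : Matrix ι κ ℍ[ℝ]) : InvMat (ι ⊕ κ) (ι ⊕ κ) where
  val := fromBlocks 1 N 0 1
  inv := fromBlocks 1 (-N) 0 1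
  val_mul_inv := by simp [fromBlocks_multiply]
  inv_mul_val := by simp [fromBlocks_multiply]

/-- The lower unitriangular block matrix with a given off-diagonal block. -/
noncomputable def lower (N : Matrix κ ι ℍ[ℝ]) : InvMat (ι ⊕ κ) (ι ⊕ κ) where
  val := fromBlocks 1 0 N 1
  inv := fromBlocks 1 0 (-N) 1
  val_mul_inv := by simp [fromBlocks_multiply]
  inv_mul_val := by simp [fromBlocks_multiply]

@[simp] theorem val_mul_inv_mul (M : InvMat ι κ) {α : Type} (X : Matrix ι α ℍ[ℝ]) :
    M.val * (M.inv * X) = X := by rw [← Matrix.mul_assoc, M.val_mul_inv, Matrix.one_mul]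

@[simp] theorem inv_mul_val_mul (M : InvMat ι κ) {α : Type} (X : Matrix κ α ℍ[ℝ]) :
    M.inv * (M.val * X) = X := by rw [← Matrix.mul_assoc, M.inv_mul_val, Matrix.one_mul]

@[simp] theorem mul_val_mul_inv (M : InvMat ι κ) {α : Type} [Fintype α] (X : Matrix α ι ℍ[ℝ]) :
    X * M.val * M.inv = X := by rw [Matrix.mul_assoc, M.val_mul_inv, Matrix.mul_one]

@[simp] theorem mul_inv_mul_val (M : InvMat ι κ) {α : Type} [Fintype α] (X : Matrix α κ ℍ[ℝ]) :
    X * M.inv * M.val = X := by rw [Matrix.mul_assoc, M.inv_mul_val, Matrix.mul_one]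

end InvMat

open Module in
/-- If the columns of `c` span the column space of `B`, there are as many of them as columns
of `B`, and sufficiently many of them vanish, then `B` and `c` are right equivalent. -/
theorem exists_eq_mul_invMat {ι κ σ : Type} [Fintype ι] [Fintype κ] [DecidableEq κ]
    [Fintype σ] [DecidableEq σ] (B : Matrix ι κ ℍ[ℝ]) (c : Matrix ι σ ℍ[ℝ])
    (hspan : colSpan c = colSpan B) (hcard : Fintype.card σ = Fintype.card κ)
    (g : Fin (Fintype.card κ - qrank B) → σ) (hg : Function.Injective g)
    (hc : ∀ a i, c i (g a) = 0) : ∃ T : InvMat σ κ, B = c * T.val := by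
  have hker : finrank (ℍ[ℝ])ᵐᵒᵖ (LinearMap.ker (mulVecRight B)) = Fintype.card κ - qrank B := by
    have h := LinearMap.finrank_range_add_finrank_ker (mulVecRight B)
    rw [range_mulVecRight, ← qrank_eq_finrank, finrank_quaternion_fun] at h
    omega
  let k := Module.finBasisOfFinrankEq (ℍ[ℝ])ᵐᵒᵖ (LinearMap.ker (mulVecRight B)) hker
  obtain ⟨w₀, hw₀⟩ := exists_eq_mul_of_colSpan_le hspan.le
  classical
  -- The family satisfies `B w_x = c_x`: at the indices `g a`, where `c` vanishes, it runs through a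
  -- basis of the kernel of `B`; elsewhere it consists of arbitrary preimages.
  let w : σ → κ → ℍ[ℝ] := fun x =>
    if h : ∃ a, g a = x then (k h.choose : κ → ℍ[ℝ]) else fun j => w₀ j x
  have hwg : ∀ a, w (g a) = k a := fun a => by
    have h : ∃ b, g b = g a := ⟨a, rfl⟩
    simp only [w, dif_pos h]
    rw [hg h.choose_spec]
  have hBw : ∀ x, B *ᵥ w x = fun i => c i x := fun x => by
    by_cases h : ∃ a, g a = x
    · obtain ⟨a, rfl⟩ := h
      rw [hwg]
      have := (k a).2
      rw [LinearMap.mem_ker, mulVecRight_apply] at this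
      rw [this]
      ext1 i
      exact (hc a i).symm
    · simp only [w, dif_neg h]
      rw [hw₀]
      rfl
  have hkerle : LinearMap.ker (mulVecRight B) ≤ Submodule.span (ℍ[ℝ])ᵐᵒᵖ (Set.range w) := by
    intro y hy
    have h : y = ∑ a, k.repr ⟨y, hy⟩ a • (k a : κ → ℍ[ℝ]) := by
      have := congrArg (LinearMap.ker (mulVecRight B)).subtype (k.sum_repr ⟨y, hy⟩)
      rw [map_sum] at this
      exact this.symm
    rw [h]
    refine Submodule.sum_mem _ fun a _ => Submodule.smul_mem _ _ ?_
    rw [← hwg]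
    exact Submodule.subset_span ⟨_, rfl⟩
  have hmap : (Submodule.span (ℍ[ℝ])ᵐᵒᵖ (Set.range w)).map (mulVecRight B) = colSpan B := by
    rw [Submodule.map_span, ← Set.range_comp, ← hspan, colSpan]
    congr 2
    ext1 x
    exact hBw x
  -- The span of `w` contains the kernel of `B` and is mapped onto the image of `B`, so it is
  -- everything. Having the right cardinality, `w` is then a basis.
  have htop : ⊤ ≤ Submodule.span (ℍ[ℝ])ᵐᵒᵖ (Set.range w) := by
    intro y _
    have hy : mulVecRight B y ∈ colSpan B := by
      rw [← range_mulVecRight]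
      exact ⟨y, rfl⟩
    rw [← hmap] at hy
    obtain ⟨z, hz, hzy⟩ := hy
    have : y - z ∈ LinearMap.ker (mulVecRight B) := by
      rw [LinearMap.mem_ker, map_sub, hzy, sub_self]
    simpa using Submodule.add_mem _ (hkerle this) hz
  let b := basisOfTopLeSpanOfCardEqFinrank w htop (by rw [hcard, finrank_quaternion_fun])
  refine ⟨(InvMat.ofBasis b).symm, ?_⟩
  have h : c = B * (InvMat.ofBasis b).val := by
    ext1 i x
    have : (fun i => c i x) = B *ᵥ b x := by
      rw [← hBw]
      simp [b]
    exact congrFun this i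
  rw [h]
  exact ((InvMat.ofBasis b).mul_val_mul_inv B).symm

/-- The rank normal form, with the identity block at the lower right corner. -/
theorem exists_rank_normal_form {ι κ : Type} [Fintype ι] [DecidableEq ι] [Fintype κ]
    [DecidableEq κ] (M : Matrix ι κ ℍ[ℝ]) {a b t : ℕ} (ht : qrank M = t)
    (ha : a + t = Fintype.card ι) (hb : b + t = Fintype.card κ) :
    ∃ (P : InvMat ι (Fin a ⊕ Fin t)) (Q : InvMat (Fin b ⊕ Fin t) κ),
      M = P.val * (fromBlocks 0 0 0 1 : Matrix (Fin a ⊕ Fin t) (Fin b ⊕ Fin t) ℍ[ℝ]) * Q.val := by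
  obtain ⟨U, W, hUW⟩ := exists_rank_factorization M ht
  have hUr : qrank U = t := by
    refine le_antisymm (by simpa using qrank_le_card U) ?_
    calc t = qrank (U * W) := by rw [← hUW, ht]
      _ ≤ qrank U := qrank_mul_le_left _ _
  -- `U` has full column rank `t`, so `(0, U)` and `M` have the same column space and differ by an
  -- invertible right factor `Q`.
  have hspan : colSpan (fromCols (0 : Matrix ι (Fin b) ℍ[ℝ]) U) = colSpan M := by
    have h0 : fromCols (0 : Matrix ι (Fin b) ℍ[ℝ]) U =
        U * (fromCols 0 1 : Matrix (Fin t) (Fin b ⊕ Fin t) ℍ[ℝ]) := by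
      rw [mul_fromCols, Matrix.mul_zero, Matrix.mul_one]
    symm
    refine Submodule.eq_of_le_of_finrank_le ?_ ?_
    · rw [colSpan_fromCols, hUW]
      exact (colSpan_mul_le U W).trans le_sup_right
    · rw [← qrank_eq_finrank, ← qrank_eq_finrank, h0, ht]
      exact (qrank_mul_le_left _ _).trans hUr.le
  obtain ⟨Q, hQ⟩ := exists_eq_mul_invMat M _ hspan (by simp [hb])
    (fun i => Sum.inl (Fin.cast (by omega) i)) (fun i j h => by simpa using h) (by simp)
  -- `Uᴴ` has `t` rows and rank `t`, so its columns span everything, as do those of `(0, 1)`. The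
  -- resulting right factor gives `P` after conjugate transposition.
  have hU : colSpan (fromCols (0 : Matrix (Fin t) (Fin a) ℍ[ℝ]) (1 : Matrix (Fin t) (Fin t) ℍ[ℝ])) = colSpan Uᴴ := by
    rw [colSpan_fromCols, colSpan_one, sup_top_eq]
    symm
    apply Submodule.eq_top_of_finrank_eq
    rw [← qrank_eq_finrank, finrank_quaternion_fun, Fintype.card_fin, qrank_conjTranspose, hUr]
  obtain ⟨P, hP⟩ := exists_eq_mul_invMat Uᴴ _ hU (by simp [ha])
    (fun i => Sum.inl (Fin.cast (by rw [qrank_conjTranspose]; omega) i))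
    (fun i j h => by simpa using h) (by simp)
  refine ⟨P.conjTranspose, Q, ?_⟩
  have hP' : U = P.valᴴ * (fromRows 0 1 : Matrix (Fin a ⊕ Fin t) (Fin t) ℍ[ℝ]) := by
    have := congrArg Matrix.conjTranspose hP
    rwa [conjTranspose_conjTranspose, conjTranspose_mul,
      conjTranspose_fromCols_eq_fromRows_conjTranspose,
      conjTranspose_zero, conjTranspose_one] at this
  have h0 : fromRows (0 : Matrix (Fin a) (Fin b) ℍ[ℝ]) (0 : Matrix (Fin t) (Fin b) ℍ[ℝ]) = 0 := by
    ext (i | i) j <;> rfl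
  rw [← Matrix.fromCols_fromRows_eq_fromBlocks, mul_fromCols, h0, Matrix.mul_zero]
  conv_lhs => rw [hQ, hP']
  rfl

/-! ### Three subspaces -/

section ThreeSubspaces

open Module Submodule

variable {R V : Type} [DivisionRing R] [AddCommGroup V] [Module R V]

/-- The lattice of subspaces is modular but not distributive. The codimension of the left side in
the right one is the multiplicity `s 4` of the two-dimensional indecomposable. -/
theorem sup_le_inf_sup (U₁ U₂ U₃ : Submodule R V) :
    U₁ ⊓ U₂ ⊔ U₁ ⊓ U₃ ≤ U₁ ⊓ (U₂ ⊔ U₃) :=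
  sup_le (inf_le_inf_left _ le_sup_left) (inf_le_inf_left _ le_sup_right)

theorem le_sup_five {a b c d e T : Submodule R V} (h : a ⊔ b ⊔ c ⊔ d ⊔ e ≤ T) :
    a ≤ T ∧ b ≤ T ∧ c ≤ T ∧ d ≤ T ∧ e ≤ T := by
  simp only [sup_le_iff] at h
  tauto

variable [FiniteDimensional R V]

/-- If `C` is a complement of `S` in the whole space, then by the modular law `C ⊓ T` is a
complement of `S` in `T`; the family is a basis of it. -/
theorem exists_span_sup_eq {S T : Submodule R V} (h : S ≤ T) {k : ℕ}
    (hk : finrank R S + k = finrank R T) :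
    ∃ v : Fin k → V, span R (Set.range v) ⊔ S = T := by
  obtain ⟨C, hC⟩ := Submodule.exists_isCompl S
  have hsup : (C ⊓ T) ⊔ S = T := by
    rw [sup_comm, ← sup_inf_assoc_of_le C h, hC.sup_eq_top, top_inf_eq]
  have hinf : (C ⊓ T) ⊓ S = ⊥ := by
    rw [eq_bot_iff, ← hC.inf_eq_bot]
    exact le_inf inf_le_right (inf_le_left.trans inf_le_left)
  have hdim := Submodule.finrank_sup_add_finrank_inf_eq (C ⊓ T) S
  rw [hsup, hinf, finrank_bot] at hdim
  let b := finBasisOfFinrankEq R ↥(C ⊓ T) (n := k) (by omega)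
  refine ⟨fun a => b a, ?_⟩
  have : span R (Set.range fun a => (b a : V)) = C ⊓ T := by
    have h1 : (Set.range fun a => (b a : V)) = (C ⊓ T).subtype '' Set.range b := by
      rw [← Set.range_comp]
      rfl
    rw [h1, ← Submodule.map_span, b.span_eq, Submodule.map_top, Submodule.range_subtype]
  rw [this, hsup]

/-- `S` is the family of the dimensions of the summands in the decomposition of the triple
`U₁, U₂, U₃` of subspaces into indecomposable triples. -/
structure TripleDims (U₁ U₂ U₃ : Submodule R V) (s : ℕ → ℕ) : Prop where
  inf₁₂₃ : finrank R ↥(U₁ ⊓ U₂ ⊓ U₃) = s 1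
  inf₁₂ : finrank R ↥(U₁ ⊓ U₂) = s 1 + s 2
  inf₁₃ : finrank R ↥(U₁ ⊓ U₃) = s 1 + s 3
  inf₂₃ : finrank R ↥(U₂ ⊓ U₃) = s 1 + s 6
  fst : finrank R U₁ = s 1 + s 2 + s 3 + s 4 + s 5
  snd : finrank R U₂ = s 4 + s 6 + s 7 + s 1 + s 2
  trd : finrank R U₃ = s 8 + s 4 + s 6 + s 3 + s 1
  sup₁₂₃ : finrank R ↥(U₁ ⊔ U₂ ⊔ U₃) = s 1 + s 2 + s 3 + s 4 + s 5 + s 4 + s 6 + s 7 + s 8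

theorem finrank_sup_inf_left (U₁ U₂ U₃ : Submodule R V) :
    finrank R ↥(U₁ ⊓ U₂ ⊔ U₁ ⊓ U₃) + finrank R ↥(U₁ ⊓ U₂ ⊓ U₃) =
      finrank R ↥(U₁ ⊓ U₂) + finrank R ↥(U₁ ⊓ U₃) := by
  rw [← Submodule.finrank_sup_add_finrank_inf_eq (U₁ ⊓ U₂), ← inf_inf_distrib_left, inf_assoc]

theorem finrank_sup_add_finrank_inf_sup (U₁ U₂ U₃ : Submodule R V) :
    finrank R ↥(U₁ ⊔ U₂ ⊔ U₃) + finrank R ↥(U₁ ⊓ (U₂ ⊔ U₃)) =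
      finrank R U₁ + finrank R ↥(U₂ ⊔ U₃) := by
  rw [← Submodule.finrank_sup_add_finrank_inf_eq U₁ (U₂ ⊔ U₃), sup_assoc]

/-- The dimensions expressed by ranks of sums and of the triple intersection. -/
theorem tripleDims_of_finrank (U₁ U₂ U₃ : Submodule R V) {s : ℕ → ℕ} {r d₁ d₂ d₃ d₁₂ d₁₃ d₂₃ d : ℕ}
    (h₁ : finrank R U₁ = d₁) (h₂ : finrank R U₂ = d₂) (h₃ : finrank R U₃ = d₃)
    (h₁₂ : finrank R ↥(U₁ ⊔ U₂) = d₁₂) (h₁₃ : finrank R ↥(U₁ ⊔ U₃) = d₁₃)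
    (h₂₃ : finrank R ↥(U₂ ⊔ U₃) = d₂₃) (h : finrank R ↥(U₁ ⊔ U₂ ⊔ U₃) = d)
    (hr : r + finrank R ↥(U₁ ⊓ U₂ ⊓ U₃) = d₁ + d₂ + d₃)
    (s1 : s 1 = d₁ + d₂ + d₃ - r) (s2 : s 2 = r - (d₁₂ + d₃)) (s3 : s 3 = r - (d₁₃ + d₂))
    (s4 : s 4 = d₁₂ + d₂₃ + d₁₃ - (d + r)) (s5 : s 5 = d - d₂₃) (s6 : s 6 = r - (d₂₃ + d₁))
    (s7 : s 7 = d - d₁₃) (s8 : s 8 = d - d₁₂) : TripleDims U₁ U₂ U₃ s := by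
  have e12 := Submodule.finrank_sup_add_finrank_inf_eq U₁ U₂
  have e13 := Submodule.finrank_sup_add_finrank_inf_eq U₁ U₃
  have e23 := Submodule.finrank_sup_add_finrank_inf_eq U₂ U₃
  have f := finrank_sup_inf_left U₁ U₂ U₃
  have g := finrank_sup_add_finrank_inf_sup U₁ U₂ U₃
  -- This and the following inequalities make the truncated subtractions defining `s` exact.
  have m4 := Submodule.finrank_mono (sup_le_inf_sup U₁ U₂ U₃)
  have m2 : finrank R ↥(U₁ ⊓ U₂ ⊓ U₃) ≤ finrank R ↥(U₁ ⊓ U₂) := finrank_mono inf_le_left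
  have m3 : finrank R ↥(U₁ ⊓ U₂ ⊓ U₃) ≤ finrank R ↥(U₁ ⊓ U₃) :=
    finrank_mono (inf_le_inf_right _ inf_le_left)
  have m6 : finrank R ↥(U₁ ⊓ U₂ ⊓ U₃) ≤ finrank R ↥(U₂ ⊓ U₃) :=
    finrank_mono (inf_le_inf_right _ inf_le_right)
  have m5 : finrank R ↥(U₂ ⊔ U₃) ≤ finrank R ↥(U₁ ⊔ U₂ ⊔ U₃) :=
    finrank_mono (sup_le_sup_right le_sup_right _)
  have m7 : finrank R ↥(U₁ ⊔ U₃) ≤ finrank R ↥(U₁ ⊔ U₂ ⊔ U₃) :=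
    finrank_mono (sup_le_sup_right le_sup_left _)
  have m8 : finrank R ↥(U₁ ⊔ U₂) ≤ finrank R ↥(U₁ ⊔ U₂ ⊔ U₃) := finrank_mono le_sup_left
  constructor <;> omega

/-- Bases of the indecomposable summands of a triple of subspaces. -/
theorem TripleDims.exists_families {U₁ U₂ U₃ : Submodule R V} {s : ℕ → ℕ}
    (hs : TripleDims U₁ U₂ U₃ s) :
    ∃ (v₁ : Fin (s 1) → V) (v₂ : Fin (s 2) → V) (v₃ : Fin (s 3) → V) (v₄ : Fin (s 4) → V)
      (v₅ : Fin (s 5) → V) (v₆ : Fin (s 4) → V) (v₇ : Fin (s 6) → V) (v₈ : Fin (s 7) → V)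
      (v₉ : Fin (s 8) → V),
      span R (Set.range v₁) ⊔ span R (Set.range v₂) ⊔ span R (Set.range v₃) ⊔
        span R (Set.range v₄) ⊔ span R (Set.range v₅) = U₁ ∧
      span R (Set.range v₆) ⊔ span R (Set.range v₇) ⊔ span R (Set.range v₈) ⊔
        span R (Set.range v₁) ⊔ span R (Set.range v₂) = U₂ ∧
      span R (Set.range v₉) ⊔ span R (Set.range (v₄ + v₆)) ⊔ span R (Set.range v₇) ⊔
        span R (Set.range v₃) ⊔ span R (Set.range v₁) = U₃ := by
  obtain ⟨h123, h12, h13, h23, hU1, hU2, hU3, hU⟩ := hs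
  obtain ⟨v₁, e₁⟩ := exists_span_sup_eq (bot_le (a := U₁ ⊓ U₂ ⊓ U₃)) (k := s 1)
    (by rw [finrank_bot]; omega)
  obtain ⟨v₂, e₂⟩ := exists_span_sup_eq (S := U₁ ⊓ U₂ ⊓ U₃) (T := U₁ ⊓ U₂) inf_le_left (k := s 2)
    (by omega)
  obtain ⟨v₃, e₃⟩ := exists_span_sup_eq (S := U₁ ⊓ U₂ ⊓ U₃) (T := U₁ ⊓ U₃)
    (inf_le_inf_right _ inf_le_left) (k := s 3) (by omega)
  obtain ⟨v₇, e₇⟩ := exists_span_sup_eq (S := U₁ ⊓ U₂ ⊓ U₃) (T := U₂ ⊓ U₃)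
    (inf_le_inf_right _ inf_le_right) (k := s 6) (by omega)
  have d12 := Submodule.finrank_sup_add_finrank_inf_eq U₁ U₂
  have d13 := Submodule.finrank_sup_add_finrank_inf_eq U₁ U₃
  have d23 := Submodule.finrank_sup_add_finrank_inf_eq U₂ U₃
  have f := finrank_sup_inf_left U₁ U₂ U₃
  have g₁ := finrank_sup_add_finrank_inf_sup U₁ U₂ U₃
  have g₂ := finrank_sup_add_finrank_inf_sup U₂ U₁ U₃
  have g₃ := finrank_sup_add_finrank_inf_sup U₃ U₁ U₂
  rw [sup_comm U₂ U₁] at g₂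
  rw [sup_comm U₃ U₁, sup_assoc, sup_comm U₃ U₂, ← sup_assoc] at g₃
  -- `v₄` measures the failure of distributivity; `v₅`, `v₈`, `v₉` complete what each `U` has in
  -- common with the sum of the other two.
  obtain ⟨v₄, e₄⟩ := exists_span_sup_eq (sup_le_inf_sup U₁ U₂ U₃) (k := s 4) (by omega)
  obtain ⟨v₅, e₅⟩ := exists_span_sup_eq (S := U₁ ⊓ (U₂ ⊔ U₃)) inf_le_left (k := s 5) (by omega)
  obtain ⟨v₈, e₈⟩ := exists_span_sup_eq (S := U₂ ⊓ (U₁ ⊔ U₃)) inf_le_left (k := s 7) (by omega)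
  obtain ⟨v₉, e₉⟩ := exists_span_sup_eq (S := U₃ ⊓ (U₁ ⊔ U₂)) inf_le_left (k := s 8) (by omega)
  have h4 : ∀ k, v₄ k ∈ U₁ ⊓ (U₂ ⊔ U₃) := fun k => by
    rw [← e₄]
    exact mem_sup_left (subset_span ⟨k, rfl⟩)
  -- Write `v₄ k = b + c` with `b ∈ U₂`, `c ∈ U₃`. Then `v₆ k = -b` lies in `U₂` and `v₄ k + v₆ k =
  -- c` in `U₃`: the three lines in a plane.
  have h6 : ∀ k, ∃ u ∈ U₂, v₄ k + u ∈ U₃ := fun k => by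
    obtain ⟨b, hb, c, hc, hbc⟩ := mem_sup.1 (h4 k).2
    refine ⟨-b, neg_mem hb, ?_⟩
    rw [← hbc]
    simpa using hc
  choose v₆ hv₆ hv₄₆ using h6
  -- Linear extension of `v₄ ↦ v₆`: the same coefficients are used for all three families.
  have c4 : ∀ x ∈ span R (Set.range v₄), ∃ y ∈ span R (Set.range v₆),
      x + y ∈ span R (Set.range (v₄ + v₆)) := by
    intro x hx
    obtain ⟨l, rfl⟩ := (mem_span_range_iff_exists_fun R).1 hx
    refine ⟨∑ i, l i • v₆ i, (mem_span_range_iff_exists_fun R).2 ⟨l, rfl⟩, ?_⟩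
    refine (mem_span_range_iff_exists_fun R).2 ⟨l, ?_⟩
    simp [Finset.sum_add_distrib]
  have l6 : span R (Set.range v₆) ≤ U₂ := span_le.2 (by rintro _ ⟨k, rfl⟩; exact hv₆ k)
  have l46 : span R (Set.range (v₄ + v₆)) ≤ U₃ := span_le.2 (by rintro _ ⟨k, rfl⟩; exact hv₄₆ k)
  rw [sup_bot_eq] at e₁
  rw [← e₁] at e₂ e₃ e₇
  have l1 := e₁.le
  have l2 : span R (Set.range v₂) ≤ U₁ ⊓ U₂ := le_sup_left.trans e₂.le
  have l3 : span R (Set.range v₃) ≤ U₁ ⊓ U₃ := le_sup_left.trans e₃.le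
  have l7 : span R (Set.range v₇) ≤ U₂ ⊓ U₃ := le_sup_left.trans e₇.le
  have l8 : span R (Set.range v₈) ≤ U₂ := le_sup_left.trans e₈.le
  have l9 : span R (Set.range v₉) ≤ U₃ := le_sup_left.trans e₉.le
  set S₁ := span R (Set.range v₁)
  set S₂ := span R (Set.range v₂)
  set S₃ := span R (Set.range v₃)
  set S₄ := span R (Set.range v₄)
  set S₅ := span R (Set.range v₅)
  set S₆ := span R (Set.range v₆)
  set S₇ := span R (Set.range v₇)
  set S₈ := span R (Set.range v₈)
  set S₉ := span R (Set.range v₉)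
  set S₄₆ := span R (Set.range (v₄ + v₆))
  refine ⟨v₁, v₂, v₃, v₄, v₅, v₆, v₇, v₈, v₉, ?_, ?_, ?_⟩
  · rw [← e₅, ← e₄, ← e₂, ← e₃]
    obtain ⟨g₁, g₂, g₃, g₄, g₅⟩ := le_sup_five (le_refl (S₁ ⊔ S₂ ⊔ S₃ ⊔ S₄ ⊔ S₅))
    refine le_antisymm ?_ (sup_le g₅ (sup_le g₄ (sup_le (sup_le g₂ g₁) (sup_le g₃ g₁))))
    have g : S₄ ⊔ (S₂ ⊔ S₁ ⊔ (S₃ ⊔ S₁)) ≤ S₅ ⊔ (S₄ ⊔ (S₂ ⊔ S₁ ⊔ (S₃ ⊔ S₁))) := le_sup_right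
    refine sup_le (sup_le (sup_le (sup_le ?_ ?_) ?_) (le_sup_left.trans g)) le_sup_left
    · exact (le_sup_right.trans le_sup_left).trans (le_sup_right.trans g)
    · exact (le_sup_left.trans le_sup_left).trans (le_sup_right.trans g)
    · exact (le_sup_left.trans le_sup_right).trans (le_sup_right.trans g)
  · apply le_antisymm
    · exact sup_le (sup_le (sup_le (sup_le l6 (l7.trans inf_le_left)) l8)
        (l1.trans (inf_le_left.trans inf_le_right))) (l2.trans inf_le_right)
    · rw [← e₈]
      obtain ⟨g₆, g₇, g₈, g₁, g₂⟩ := le_sup_five (le_refl (S₆ ⊔ S₇ ⊔ S₈ ⊔ S₁ ⊔ S₂))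
      refine sup_le g₈ ?_
      rintro x ⟨hx2, hx⟩
      obtain ⟨a, ha, c, hc, rfl⟩ := mem_sup.1 hx
      have haN : a ∈ U₁ ⊓ (U₂ ⊔ U₃) := by
        refine ⟨ha, mem_sup.2 ⟨a + c, hx2, -c, neg_mem hc, by abel⟩⟩
      rw [← e₄] at haN
      obtain ⟨w, hw, n, hn, rfl⟩ := mem_sup.1 haN
      obtain ⟨p, hp, q, hq, rfl⟩ := mem_sup.1 hn
      obtain ⟨y, hy, hwy⟩ := c4 w hw
      -- With `x = w + p + q + c` this vector is `x - p + y`, visibly in `U₂`, while its three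
      -- summands lie in `U₃`. So `x` is reached from `U₂ ⊓ U₃`, `p ∈ U₁ ⊓ U₂` and `y` in the span
      -- of `v₆`.
      have hz : q + (w + y) + c ∈ U₂ ⊓ U₃ := by
        refine ⟨?_, add_mem (add_mem hq.2 (l46 hwy)) hc⟩
        have : q + (w + y) + c = (w + (p + q) + c) - p + y := by abel
        rw [this]
        exact add_mem (sub_mem hx2 hp.2) (l6 hy)
      have : w + (p + q) + c = p + (q + (w + y) + c) - y := by abel
      rw [this]
      rw [← e₇] at hz
      rw [← e₂] at hp
      refine sub_mem (add_mem (sup_le g₂ g₁ hp) ?_) (g₆ hy)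
      exact sup_le g₇ g₁ hz
  · apply le_antisymm
    · exact sup_le (sup_le (sup_le (sup_le l9 l46) (l7.trans inf_le_right))
        (l3.trans inf_le_right)) (l1.trans inf_le_right)
    · rw [← e₉]
      obtain ⟨g₉, g₄₆, g₇, g₃, g₁⟩ := le_sup_five (le_refl (S₉ ⊔ S₄₆ ⊔ S₇ ⊔ S₃ ⊔ S₁))
      refine sup_le g₉ ?_
      rintro x ⟨hx3, hx⟩
      obtain ⟨a, ha, c, hc, rfl⟩ := mem_sup.1 hx
      have haN : a ∈ U₁ ⊓ (U₂ ⊔ U₃) := by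
        refine ⟨ha, mem_sup.2 ⟨-c, neg_mem hc, a + c, hx3, by abel⟩⟩
      rw [← e₄] at haN
      obtain ⟨w, hw, n, hn, rfl⟩ := mem_sup.1 haN
      obtain ⟨p, hp, q, hq, rfl⟩ := mem_sup.1 hn
      obtain ⟨y, hy, hwy⟩ := c4 w hw
      -- The mirror image of the argument for `U₂`: the summands lie in `U₂`, and the vector equals
      -- `x - q - (w + y)`, which lies in `U₃`.
      have hz : p - y + c ∈ U₂ ⊓ U₃ := by
        refine ⟨add_mem (sub_mem hp.2 (l6 hy)) hc, ?_⟩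
        have : p - y + c = (w + (p + q) + c) - q - (w + y) := by abel
        rw [this]
        exact sub_mem (sub_mem hx3 hq.2) (l46 hwy)
      have : w + (p + q) + c = (p - y + c) + q + (w + y) := by abel
      rw [this]
      rw [← e₇] at hz
      rw [← e₃] at hq
      refine add_mem (add_mem (sup_le g₇ g₁ hz) ?_) (g₄₆ hwy)
      exact sup_le g₃ g₁ hq

end ThreeSubspaces

/-! ### Block patterns -/

section Patterns

variable {ι κ : Type}

/-- The sizes at an identity position are not assumed equal, so the formula must guard against
indices outside the row block. In the applications the sizes agree and the guard holds. -/
theorem mul_identPattern_apply {k l : ℕ} {r c : ℕ → ℕ} (S : Finset (ℕ × ℕ))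
    (M : Matrix ι (BlockIdx k r) ℍ[ℝ]) (x : ι) (y : BlockIdx l c) :
    (M * identPattern k l r c S) x y = ∑ i : Fin k, if (i.val + 1, y.1.val + 1) ∈ S then
      (if h : y.2.val < r (i.val + 1) then M x ⟨i, y.2.val, h⟩ else 0) else 0 := by
  rw [Matrix.mul_apply, Fintype.sum_sigma]
  refine Finset.sum_congr rfl fun i _ => ?_
  split_ifs with h1 h2
  · rw [Finset.sum_eq_single ⟨y.2.val, h2⟩]
    · simp [identPattern, h1]
    · intro b _ hb
      have : b.val ≠ y.2.val := fun h => hb (Fin.ext h)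
      simp [identPattern, this]
    · simp
  · refine Finset.sum_eq_zero fun b _ => ?_
    have : b.val ≠ y.2.val := fun h => h2 (h ▸ b.2)
    simp [identPattern, this]
  · simp [identPattern, h1]

theorem identPattern_mul_apply {k l : ℕ} {r c : ℕ → ℕ} (S : Finset (ℕ × ℕ))
    (M : Matrix (BlockIdx l c) ι ℍ[ℝ]) (x : BlockIdx k r) (y : ι) :
    (identPattern k l r c S * M) x y = ∑ j : Fin l, if (x.1.val + 1, j.val + 1) ∈ S then
      (if h : x.2.val < c (j.val + 1) then M ⟨j, x.2.val, h⟩ y else 0) else 0 := by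
  rw [Matrix.mul_apply, Fintype.sum_sigma]
  refine Finset.sum_congr rfl fun i _ => ?_
  split_ifs with h1 h2
  · rw [Finset.sum_eq_single ⟨x.2.val, h2⟩]
    · simp [identPattern, h1]
    · intro b _ hb
      have : x.2.val ≠ b.val := fun h => hb (Fin.ext h.symm)
      simp [identPattern, this]
    · simp
  · refine Finset.sum_eq_zero fun b _ => ?_
    have : x.2.val ≠ b.val := fun h => h2 (h ▸ b.2)
    simp [identPattern, this]
  · simp [identPattern, h1]

/-- The matrix whose columns are the members of `k` families of column vectors. -/
noncomputable def colMat (k : ℕ) {c : ℕ → ℕ} (v : ∀ i, Fin (c i) → ι → ℍ[ℝ]) :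
    Matrix ι (BlockIdx k c) ℍ[ℝ] :=
  Matrix.of fun x y => v (y.1.val + 1) y.2 x

theorem colSpan_colMat (k : ℕ) {c : ℕ → ℕ} (v : ∀ i, Fin (c i) → ι → ℍ[ℝ]) :
    colSpan (colMat k v) =
      ⨆ i : Fin k, Submodule.span (ℍ[ℝ])ᵐᵒᵖ (Set.range (v (i.val + 1))) := by
  rw [← Submodule.span_iUnion, colSpan]
  congr 1
  ext x
  simp only [Set.mem_range, Set.mem_iUnion, Sigma.exists]
  rfl

theorem exists_eq_colMat_mul [Fintype ι] {p : ℕ} (B : Matrix ι (Fin p) ℍ[ℝ]) {c : ℕ → ℕ}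
    (w : ∀ i, Fin (c i) → ι → ℍ[ℝ]) (hw : w 6 = 0)
    (hspan : Submodule.span (ℍ[ℝ])ᵐᵒᵖ (Set.range (w 1)) ⊔
      Submodule.span (ℍ[ℝ])ᵐᵒᵖ (Set.range (w 2)) ⊔ Submodule.span (ℍ[ℝ])ᵐᵒᵖ (Set.range (w 3)) ⊔
      Submodule.span (ℍ[ℝ])ᵐᵒᵖ (Set.range (w 4)) ⊔ Submodule.span (ℍ[ℝ])ᵐᵒᵖ (Set.range (w 5)) =
        colSpan B)
    (hr : qrank B = c 1 + c 2 + c 3 + c 4 + c 5) (h6 : c 6 = p - qrank B) :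
    ∃ T : InvMat (BlockIdx 6 c) (Fin p), B = colMat 6 w * T.val := by
  have hp : qrank B ≤ p := by simpa using qrank_le_card B
  -- The index `5 : Fin 6` is the block labelled 6; its `p - qrank B` columns are the zero columns
  -- matched with the kernel of `B`.
  refine exists_eq_mul_invMat B (colMat 6 w) ?_ ?_ (fun a => ⟨5, Fin.cast (by simp [h6]) a⟩) ?_ ?_
  · rw [colSpan_colMat, ← hspan]
    apply le_antisymm
    · obtain ⟨g₁, g₂, g₃, g₄, g₅⟩ := le_sup_five hspan.le
      rw [hspan]
      refine iSup_le fun i => ?_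
      fin_cases i
      · exact g₁
      · exact g₂
      · exact g₃
      · exact g₄
      · exact g₅
      · refine Submodule.span_le.2 ?_
        rintro _ ⟨a, rfl⟩
        exact (congrFun hw a).symm ▸ Submodule.zero_mem _
    · have h := fun i => le_iSup
        (fun i : Fin 6 => Submodule.span (ℍ[ℝ])ᵐᵒᵖ (Set.range (w (i.val + 1)))) i
      exact sup_le (sup_le (sup_le (sup_le (h 0) (h 1)) (h 2)) (h 3)) (h 4)
  · rw [Fintype.card_sigma]
    simp only [Fin.sum_univ_six, Fintype.card_fin]
    change c 1 + c 2 + c 3 + c 4 + c 5 + c 6 = p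
    omega
  · intro a b h
    simpa [Fin.ext_iff] using h
  · intro a i
    exact congrFun (congrFun hw _) i

end Patterns

/-- The sizes of the eleven block rows of the normal form. -/
def rowSizes (s : ℕ → ℕ) (a b : ℕ) : ℕ → ℕ
  | 1 => s 1
  | 2 => s 2
  | 3 => s 3
  | 4 => s 4
  | 5 => s 5
  | 6 => s 4
  | 7 => s 6
  | 8 => s 7
  | 9 => s 8
  | 10 => a
  | 11 => b
  | _ => 0

/-- The sizes of the block columns of `S_B`. -/
def sizesB (s : ℕ → ℕ) (k : ℕ) : ℕ → ℕ
  | 1 => s 1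
  | 2 => s 2
  | 3 => s 3
  | 4 => s 4
  | 5 => s 5
  | 6 => k
  | _ => 0

/-- The sizes of the block columns of `S_C`. -/
def sizesC (s : ℕ → ℕ) (k : ℕ) : ℕ → ℕ
  | 1 => s 4
  | 2 => s 6
  | 3 => s 7
  | 4 => s 1
  | 5 => s 2
  | 6 => k
  | _ => 0

/-- The sizes of the block columns of `S_D`. -/
def sizesD (s : ℕ → ℕ) (k : ℕ) : ℕ → ℕ
  | 1 => s 8
  | 2 => s 4
  | 3 => s 6
  | 4 => s 3
  | 5 => s 1
  | 6 => k
  | _ => 0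

/-! ### Normal form of three matrices with a common row space of indices -/

section TripleForm

variable {m p₁ p₂ p₃ : ℕ}

/-- The families spanning `V`, in the order of the block rows of the normal form. -/
def rowFamilies {V : Type} [Zero V] {s : ℕ → ℕ} (a b : ℕ) (v₁ : Fin (s 1) → V) (v₂ : Fin (s 2) → V)
    (v₃ : Fin (s 3) → V) (v₄ : Fin (s 4) → V) (v₅ : Fin (s 5) → V) (v₆ : Fin (s 4) → V)
    (v₇ : Fin (s 6) → V) (v₈ : Fin (s 7) → V) (v₉ : Fin (s 8) → V) :
    ∀ i, Fin (rowSizes s a b i) → V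
  | 1 => v₁
  | 2 => v₂
  | 3 => v₃
  | 4 => v₄
  | 5 => v₅
  | 6 => v₆
  | 7 => v₇
  | 8 => v₈
  | 9 => v₉
  | _ => 0

/-- The families spanning the column space of `B`. -/
def familiesB {V : Type} [Zero V] {s : ℕ → ℕ} (k : ℕ) (v₁ : Fin (s 1) → V) (v₂ : Fin (s 2) → V)
    (v₃ : Fin (s 3) → V) (v₄ : Fin (s 4) → V) (v₅ : Fin (s 5) → V) :
    ∀ i, Fin (sizesB s k i) → V
  | 1 => v₁
  | 2 => v₂
  | 3 => v₃
  | 4 => v₄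
  | 5 => v₅
  | _ => 0

/-- The families spanning the column space of `C`. -/
def familiesC {V : Type} [Zero V] {s : ℕ → ℕ} (k : ℕ) (v₁ : Fin (s 4) → V) (v₂ : Fin (s 6) → V)
    (v₃ : Fin (s 7) → V) (v₄ : Fin (s 1) → V) (v₅ : Fin (s 2) → V) :
    ∀ i, Fin (sizesC s k i) → V
  | 1 => v₁
  | 2 => v₂
  | 3 => v₃
  | 4 => v₄
  | 5 => v₅
  | _ => 0

/-- The families spanning the column space of `D`. -/
def familiesD {V : Type} [Zero V] {s : ℕ → ℕ} (k : ℕ) (v₁ : Fin (s 8) → V) (v₂ : Fin (s 4) → V)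
    (v₃ : Fin (s 6) → V) (v₄ : Fin (s 3) → V) (v₅ : Fin (s 1) → V) :
    ∀ i, Fin (sizesD s k i) → V
  | 1 => v₁
  | 2 => v₂
  | 3 => v₃
  | 4 => v₄
  | 5 => v₅
  | _ => 0

/-- A pattern of identity blocks, extended by `k` zero rows. -/
noncomputable def padPattern (k : ℕ) (r c : ℕ → ℕ) (S : Finset (ℕ × ℕ)) :
    Matrix (BlockIdx 9 r ⊕ Fin k) (BlockIdx 6 c) ℍ[ℝ] :=
  fromRows (identPattern 9 6 r c S) 0

open Module in
/-- Simultaneous normal form of three matrices with the same number of rows. -/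
theorem exists_triple_form (B : Matrix (Fin m) (Fin p₁) ℍ[ℝ]) (C : Matrix (Fin m) (Fin p₂) ℍ[ℝ])
    (D : Matrix (Fin m) (Fin p₃) ℍ[ℝ]) {s : ℕ → ℕ}
    (hs : TripleDims (colSpan B) (colSpan C) (colSpan D) s) (a b : ℕ) {k d d₁ d₂ d₃ : ℕ}
    (h₁ : qrank B = d₁) (h₂ : qrank C = d₂) (h₃ : qrank D = d₃)
    (hd : finrank (ℍ[ℝ])ᵐᵒᵖ ↥(colSpan B ⊔ colSpan C ⊔ colSpan D) = d) (hk : d + k = m) :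
    ∃ (P : InvMat (Fin m) (BlockIdx 9 (rowSizes s a b) ⊕ Fin k))
      (T₁ : InvMat (BlockIdx 6 (sizesB s (p₁ - d₁))) (Fin p₁))
      (T₂ : InvMat (BlockIdx 6 (sizesC s (p₂ - d₂))) (Fin p₂))
      (T₃ : InvMat (BlockIdx 6 (sizesD s (p₃ - d₃))) (Fin p₃)),
      B = P.val * padPattern k (rowSizes s a b) (sizesB s (p₁ - d₁)) patB * T₁.val ∧
      C = P.val * padPattern k (rowSizes s a b) (sizesC s (p₂ - d₂)) patC * T₂.val ∧
      D = P.val * padPattern k (rowSizes s a b) (sizesD s (p₃ - d₃)) patD * T₃.val ∧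
      colSpan (P.val.submatrix id Sum.inl) = colSpan B ⊔ colSpan C ⊔ colSpan D := by
  subst h₁ h₂ h₃
  obtain ⟨v₁, v₂, v₃, v₄, v₅, v₆, v₇, v₈, v₉, hB, hC, hD⟩ := hs.exists_families
  obtain ⟨v₀, hv₀⟩ := exists_span_sup_eq (le_top (a := colSpan B ⊔ colSpan C ⊔ colSpan D)) (k := k)
    (by rw [finrank_top, finrank_quaternion_fun, Fintype.card_fin, hd, hk])
  let P₉ := colMat 9 (rowFamilies a b v₁ v₂ v₃ v₄ v₅ v₆ v₇ v₈ v₉)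
  have hP₉ : colSpan P₉ = colSpan B ⊔ colSpan C ⊔ colSpan D := by
    obtain ⟨b₁, b₂, b₃, b₄, b₅⟩ := le_sup_five hB.le
    obtain ⟨c₁, c₂, c₃, c₄, c₅⟩ := le_sup_five hC.le
    obtain ⟨d₁, d₂, d₃, d₄, d₅⟩ := le_sup_five hD.le
    have hBU : colSpan B ≤ colSpan B ⊔ colSpan C ⊔ colSpan D := le_sup_left.trans le_sup_left
    have hCU : colSpan C ≤ colSpan B ⊔ colSpan C ⊔ colSpan D := le_sup_right.trans le_sup_left
    have hDU : colSpan D ≤ colSpan B ⊔ colSpan C ⊔ colSpan D := le_sup_right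
    simp only [P₉, colSpan_colMat]
    apply le_antisymm
    · refine iSup_le fun i => ?_
      fin_cases i
      · exact b₁.trans hBU
      · exact b₂.trans hBU
      · exact b₃.trans hBU
      · exact b₄.trans hBU
      · exact b₅.trans hBU
      · exact c₁.trans hCU
      · exact c₂.trans hCU
      · exact c₃.trans hCU
      · exact d₁.trans hDU
    · have h := fun i => le_iSup (fun i : Fin 9 => Submodule.span (ℍ[ℝ])ᵐᵒᵖ
        (Set.range (rowFamilies a b v₁ v₂ v₃ v₄ v₅ v₆ v₇ v₈ v₉ (i.val + 1)))) i
      refine sup_le (sup_le ?_ ?_) ?_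
      · rw [← hB]
        exact sup_le (sup_le (sup_le (sup_le (h 0) (h 1)) (h 2)) (h 3)) (h 4)
      · rw [← hC]
        exact sup_le (sup_le (sup_le (sup_le (h 5) (h 6)) (h 7)) (h 0)) (h 1)
      · rw [← hD]
        refine sup_le (sup_le (sup_le (sup_le (h 8) ?_) (h 6)) (h 2)) (h 0)
        refine Submodule.span_le.2 ?_
        rintro _ ⟨x, rfl⟩
        exact Submodule.add_mem _ (h 3 (Submodule.subset_span ⟨x, rfl⟩))
          (h 5 (Submodule.subset_span ⟨x, rfl⟩))
  let u : BlockIdx 9 (rowSizes s a b) ⊕ Fin k → Fin m → ℍ[ℝ] :=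
    Sum.elim (fun y i => P₉ i y) v₀
  have hu : ⊤ ≤ Submodule.span (ℍ[ℝ])ᵐᵒᵖ (Set.range u) := by
    rw [← hv₀, ← hP₉, Set.Sum.elim_range, Submodule.span_union, sup_comm]
    exact le_rfl
  -- Counting replaces linear independence: a spanning family of `m` vectors is a basis.
  have hcard : Fintype.card (BlockIdx 9 (rowSizes s a b) ⊕ Fin k) =
      finrank (ℍ[ℝ])ᵐᵒᵖ (Fin m → ℍ[ℝ]) := by
    rw [finrank_quaternion_fun, Fintype.card_fin, ← hk, ← hd, hs.sup₁₂₃, Fintype.card_sum,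
      Fintype.card_sigma, Fintype.card_fin]
    simp only [Fin.sum_univ_succ, Fintype.card_fin, Fin.sum_univ_zero]
    change s 1 + (s 2 + (s 3 + (s 4 + (s 5 + (s 4 + (s 6 + (s 7 + (s 8 + 0)))))))) + k = _
    omega
  let bas := basisOfTopLeSpanOfCardEqFinrank u hu hcard
  let P := InvMat.ofBasis bas
  have hP : P.val = fromCols P₉ (Matrix.of fun i x => v₀ x i) := by
    ext1 i x
    rcases x with x | x <;> simp [P, bas, u]
  have hPS : ∀ {c : ℕ → ℕ} (S : Finset (ℕ × ℕ)),
      P.val * padPattern k (rowSizes s a b) c S = P₉ * identPattern 9 6 (rowSizes s a b) c S := fun S => by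
    rw [hP, padPattern, fromCols_mul_fromRows, Matrix.mul_zero, add_zero]
  obtain ⟨T₁, hT₁⟩ := exists_eq_colMat_mul B (familiesB (p₁ - qrank B) v₁ v₂ v₃ v₄ v₅) rfl hB
    hs.fst rfl
  obtain ⟨T₂, hT₂⟩ := exists_eq_colMat_mul C (familiesC (p₂ - qrank C) v₆ v₇ v₈ v₁ v₂) rfl hC
    hs.snd rfl
  obtain ⟨T₃, hT₃⟩ := exists_eq_colMat_mul D
    (familiesD (p₃ - qrank D) v₉ (v₄ + v₆) v₇ v₃ v₁) rfl hD hs.trd rfl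
  refine ⟨P, T₁, T₂, T₃, ?_, ?_, ?_, ?_⟩
  · rw [hPS]
    conv_lhs => rw [hT₁]
    congr 1
    ext1 i ⟨j, x⟩
    rw [mul_identPattern_apply]
    fin_cases j <;> simp [Fin.sum_univ_succ, patB]
    all_goals first | rfl | (rw [dif_pos (by exact x.2)]; rfl)
  · rw [hPS]
    conv_lhs => rw [hT₂]
    congr 1
    ext1 i ⟨j, x⟩
    rw [mul_identPattern_apply]
    fin_cases j <;> simp [Fin.sum_univ_succ, patC]
    all_goals first | rfl | (rw [dif_pos (by exact x.2)]; rfl)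
  · rw [hPS]
    conv_lhs => rw [hT₃]
    congr 1
    ext1 i ⟨j, x⟩
    rw [mul_identPattern_apply]
    fin_cases j <;> simp [Fin.sum_univ_succ, patD]
    -- The alternative with two guards is block column 2 of `patD`, whose identity blocks in rows 4
    -- and 6 produce the sum `v₄ + v₆`.
    all_goals first | rfl | (rw [dif_pos (by exact x.2)]; rfl) |
      (rw [dif_pos (by exact x.2), dif_pos (by exact x.2)]; rfl)
  · rw [← hP₉, hP]
    rfl

end TripleForm

/-! ### Ranks of block matrices -/

section BlockRanks

open Module

variable {ι κ μ ν : Type}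

theorem colSpan_fromRows_self (M : Matrix ι μ ℍ[ℝ]) :
    colSpan (fromRows M M) = (colSpan M).map (extendUpper ι ι + extendLower ι ι) := by
  rw [colSpan, colSpan, Submodule.map_span, ← Set.range_comp]
  congr 2
  ext1 j
  ext1 (i | i) <;> simp

/-- The columns span the sum of the diagonal copy of `colSpan D` and of `colSpan B ⊕ colSpan C`.
These two meet in the diagonal copy of the triple intersection, and the dimension formula for a sum
finishes the proof. -/
theorem qrank_triple_add_finrank_inf [Fintype ι] (B : Matrix ι κ ℍ[ℝ]) (C : Matrix ι μ ℍ[ℝ])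
    (D : Matrix ι ν ℍ[ℝ]) :
    qrank (fromCols (fromRows D D) (fromCols (fromRows B 0) (fromRows 0 C)) :
      Matrix (ι ⊕ ι) (ν ⊕ κ ⊕ μ) ℍ[ℝ]) +
        finrank (ℍ[ℝ])ᵐᵒᵖ ↥(colSpan B ⊓ colSpan C ⊓ colSpan D) =
      qrank B + qrank C + qrank D := by
  have hinj : Function.Injective (extendUpper ι ι + extendLower ι ι) := fun x y h => by
    ext1 i
    simpa using congrFun h (Sum.inl i)
  have h := Submodule.finrank_sup_add_finrank_inf_eq
    ((colSpan D).map (extendUpper ι ι + extendLower ι ι))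
    ((colSpan B).map (extendUpper ι ι) ⊔ (colSpan C).map (extendLower ι ι))
  have hinf : (colSpan D).map (extendUpper ι ι + extendLower ι ι) ⊓
      ((colSpan B).map (extendUpper ι ι) ⊔ (colSpan C).map (extendLower ι ι)) =
        (colSpan B ⊓ colSpan C ⊓ colSpan D).map (extendUpper ι ι + extendLower ι ι) := by
    apply le_antisymm
    · rintro _ ⟨⟨d, hd, rfl⟩, hx⟩
      obtain ⟨_, ⟨b, hb, rfl⟩, _, ⟨c, hc, rfl⟩, hbc⟩ := Submodule.mem_sup.1 hx
      have h1 : b = d := by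
        ext1 i
        simpa using congrFun hbc (Sum.inl i)
      have h2 : c = d := by
        ext1 i
        simpa using congrFun hbc (Sum.inr i)
      subst h1
      subst h2
      exact ⟨_, ⟨⟨hb, hc⟩, hd⟩, rfl⟩
    · rintro _ ⟨d, ⟨⟨hb, hc⟩, hd⟩, rfl⟩
      exact ⟨⟨d, hd, rfl⟩, Submodule.add_mem_sup ⟨d, hb, rfl⟩ ⟨d, hc, rfl⟩⟩
  rw [hinf, finrank_map_extendUpper_sup_map_extendLower,
    ← (Submodule.equivMapOfInjective _ hinj _).finrank_eq,
    ← (Submodule.equivMapOfInjective _ hinj _).finrank_eq] at h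
  rw [qrank_eq_finrank, colSpan_fromCols, colSpan_fromCols, colSpan_fromRows_self,
    colSpan_fromRows_zero, colSpan_zero_fromRows, h]
  simp only [qrank_eq_finrank]
  omega

variable [Fintype ι] [DecidableEq ι] [Fintype κ] [DecidableEq κ] [Fintype μ] [DecidableEq μ]
  [Fintype ν] [DecidableEq ν]

theorem qrank_invMat_mul (P : InvMat ι κ) (M : Matrix κ μ ℍ[ℝ]) (Q : InvMat μ ν) :
    qrank (P.val * M * Q.val) = qrank M :=
  qrank_eq_of_mul_eq P.val Q.val P.inv Q.inv rfl (by simp [Matrix.mul_assoc, Q.val_mul_inv])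

/-- The block diagonal matrix with a given invertible block and an identity block. -/
noncomputable def InvMat.diagOne (M : InvMat μ ν) (κ : Type) [Fintype κ] [DecidableEq κ] :
    InvMat (μ ⊕ κ) (ν ⊕ κ) where
  val := fromBlocks M.val 0 0 1
  inv := fromBlocks M.inv 0 0 1
  val_mul_inv := by simp [fromBlocks_multiply, M.val_mul_inv]
  inv_mul_val := by simp [fromBlocks_multiply, M.inv_mul_val]

/-- The identity blocks of the border clear every block except `S₂₂`: the lower border removes
`S₂₁`, the right border removes `S₁₁` and `S₁₂`. A permutation then gives `diag(1, 1, S₂₂)`. -/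
theorem qrank_fromBlocks_one_one (S₁₁ : Matrix ι κ ℍ[ℝ]) (S₁₂ : Matrix ι ν ℍ[ℝ])
    (S₂₁ : Matrix μ κ ℍ[ℝ]) (S₂₂ : Matrix μ ν ℍ[ℝ]) :
    qrank (fromBlocks (fromBlocks S₁₁ S₁₂ S₂₁ S₂₂) (fromRows 1 0) (fromCols 1 0) 0 :
      Matrix ((ι ⊕ μ) ⊕ κ) ((κ ⊕ ν) ⊕ ι) ℍ[ℝ]) =
        Fintype.card ι + Fintype.card κ + qrank S₂₂ := by
  let Z : Matrix ((ι ⊕ μ) ⊕ κ) ((κ ⊕ ν) ⊕ ι) ℍ[ℝ] :=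
    fromBlocks (fromBlocks 0 0 0 S₂₂) (fromRows 1 0) (fromCols 1 0) 0
  have h : (fromBlocks (fromBlocks S₁₁ S₁₂ S₂₁ S₂₂) (fromRows 1 0) (fromCols 1 0) 0 :
      Matrix ((ι ⊕ μ) ⊕ κ) ((κ ⊕ ν) ⊕ ι) ℍ[ℝ]) =
        (InvMat.upper (fromRows 0 S₂₁ : Matrix (ι ⊕ μ) κ ℍ[ℝ])).val * Z *
          (InvMat.lower (fromCols S₁₁ S₁₂)).val := by
    simp only [InvMat.upper, InvMat.lower, Z, fromBlocks_multiply]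
    simp only [Matrix.one_mul, Matrix.mul_one, Matrix.zero_mul, Matrix.mul_zero, add_zero, zero_add,
      fromRows_mul_fromCols, fromBlocks_add]
  rw [h, qrank_invMat_mul]
  let e : ι ⊕ (κ ⊕ μ) ≃ (ι ⊕ μ) ⊕ κ :=
    (Equiv.sumCongr (Equiv.refl _) (Equiv.sumComm _ _)).trans (Equiv.sumAssoc _ _ _).symm
  let f : ι ⊕ (κ ⊕ ν) ≃ (κ ⊕ ν) ⊕ ι := Equiv.sumComm _ _
  have hZ : Z.submatrix e f =
      fromBlocks (1 : Matrix ι ι ℍ[ℝ]) 0 0 (fromBlocks (1 : Matrix κ κ ℍ[ℝ]) 0 0 S₂₂) := by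
    ext1 x y
    rcases x with x | x | x <;> rcases y with y | y | y <;> rfl
  rw [← qrank_submatrix_equiv Z e f, hZ, qrank_fromBlocks_diagonal, qrank_fromBlocks_diagonal,
    qrank_one, qrank_one, add_assoc]

end BlockRanks

/-- The rank of a matrix bordered by `N` and `M`, in terms of the corner complementary to the
column space of `N` and to the row space of `M`. -/
theorem qrank_bordered {ι κ μ ν α β a b : Type} [Fintype ι] [DecidableEq ι]
    [Fintype κ] [DecidableEq κ] [Fintype μ] [Fintype ν] [Fintype α] [DecidableEq α] [Fintype β] [DecidableEq β]
    [Fintype a] [DecidableEq a] [Fintype b] [DecidableEq b]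
    (A : Matrix ι κ ℍ[ℝ]) (N : Matrix ι ν ℍ[ℝ]) (M : Matrix μ κ ℍ[ℝ])
    (P : InvMat ι (α ⊕ a)) (Q : InvMat (β ⊕ b) κ)
    (hN : colSpan (P.val.submatrix id Sum.inl) = colSpan N)
    (hM : colSpan (Q.valᴴ.submatrix id Sum.inl) = colSpan Mᴴ) :
    qrank (fromBlocks A N M 0) =
      Fintype.card α + Fintype.card β + qrank (P.inv * A * Q.inv).toBlocks₂₂ := by
  obtain ⟨X, hX⟩ := exists_eq_mul_of_colSpan_le hN.ge
  obtain ⟨X', hX'⟩ := exists_eq_mul_of_colSpan_le hN.le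
  obtain ⟨Y, hY⟩ := exists_eq_mul_of_colSpan_le hM.ge
  obtain ⟨Y', hY'⟩ := exists_eq_mul_of_colSpan_le hM.le
  replace hY := congrArg Matrix.conjTranspose hY
  replace hY' := congrArg Matrix.conjTranspose hY'
  rw [conjTranspose_mul, conjTranspose_conjTranspose] at hY hY'
  set P₁ := P.val.submatrix id Sum.inl with hP₁
  set Q₁ := Q.val.submatrix Sum.inl id with hQ₁
  have hQ₁' : (Q.valᴴ.submatrix id Sum.inl)ᴴ = Q₁ := by
    rw [← conjTranspose_submatrix, conjTranspose_conjTranspose]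
  rw [hQ₁'] at hY hY'
  -- `N` and `P₁` have the same column space, so each is a right multiple of the other; dually for
  -- the row spaces of `M` and `Q₁`. Exchanging the borders preserves the rank.
  have h1 : qrank (fromBlocks A N M 0) = qrank (fromBlocks A P₁ Q₁ 0) := by
    refine qrank_eq_of_mul_eq (fromBlocks 1 0 0 Yᴴ) (fromBlocks 1 0 0 X) (fromBlocks 1 0 0 Y'ᴴ)
      (fromBlocks 1 0 0 X') ?_ ?_
    · simp only [fromBlocks_multiply]
      simp [← hX, ← hY]
    · simp only [fromBlocks_multiply]
      simp [← hX', ← hY']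
  -- Pulling out `P` and `Q` turns the border into identity blocks.
  have h2 : fromBlocks A P₁ Q₁ (0 : Matrix β α ℍ[ℝ]) = (P.diagOne β).val *
      (fromBlocks (P.inv * A * Q.inv) (fromRows 1 0) (fromCols 1 0) 0 :
        Matrix ((α ⊕ a) ⊕ β) ((β ⊕ b) ⊕ α) ℍ[ℝ]) * (Q.diagOne α).val := by
    have hp : P.val * (fromRows 1 0 : Matrix (α ⊕ a) α ℍ[ℝ]) = P₁ := by
      conv_lhs => rw [← Matrix.fromCols_toCols P.val]
      rw [fromCols_mul_fromRows, Matrix.mul_one, Matrix.mul_zero, add_zero]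
      rfl
    have hq : (fromCols 1 0 : Matrix β (β ⊕ b) ℍ[ℝ]) * Q.val = Q₁ := by
      conv_lhs => rw [← Matrix.fromRows_toRows Q.val]
      rw [fromCols_mul_fromRows, Matrix.one_mul, Matrix.zero_mul, add_zero]
      rfl
    simp only [InvMat.diagOne, fromBlocks_multiply]
    simp [hp, hq, Matrix.mul_assoc, Q.inv_mul_val]
  rw [h1, h2, qrank_invMat_mul, ← qrank_fromBlocks_one_one (P.inv * A * Q.inv).toBlocks₁₁
    (P.inv * A * Q.inv).toBlocks₁₂ (P.inv * A * Q.inv).toBlocks₂₁, fromBlocks_toBlocks]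

/-! ### Existence of the simultaneous decomposition -/

/-- The blocks of a matrix whose rows and columns are labelled by blocks. -/
noncomputable def blocksOf {k l : ℕ} {r c : ℕ → ℕ} (S : Matrix (BlockIdx k r) (BlockIdx l c) ℍ[ℝ]) :
    ∀ i j : ℕ, Matrix (Fin (r i)) (Fin (c j)) ℍ[ℝ]
  | i + 1, j + 1 => Matrix.of fun x y =>
    if h : i < k ∧ j < l then S ⟨⟨i, h.1⟩, x⟩ ⟨⟨j, h.2⟩, y⟩ else 0
  | _, _ => 0

theorem blocksOf_succ {k l : ℕ} {r c : ℕ → ℕ} (S : Matrix (BlockIdx k r) (BlockIdx l c) ℍ[ℝ])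
    {i j : ℕ} (hi : i < k) (hj : j < l) (x : Fin (r (i + 1))) (y : Fin (c (j + 1))) :
    blocksOf S (i + 1) (j + 1) x y = S ⟨⟨i, hi⟩, x⟩ ⟨⟨j, hj⟩, y⟩ :=
  dif_pos ⟨hi, hj⟩

theorem blockMat_blocksOf {k l : ℕ} {r c : ℕ → ℕ} (S : Matrix (BlockIdx k r) (BlockIdx l c) ℍ[ℝ]) :
    blockMat k l (blocksOf S) = S := by
  ext1 ⟨i, x⟩ ⟨j, y⟩
  exact dif_pos ⟨i.2, j.2⟩

/-- The splitting of eleven blocks into the first nine and the last two. -/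
def joinBlocks (r : ℕ → ℕ) : BlockIdx 9 r ⊕ (Fin (r 10) ⊕ Fin (r 11)) → BlockIdx 11 r :=
  Sum.elim (fun x => ⟨Fin.castLE (by decide) x.1, x.2⟩)
    (Sum.elim (fun x => ⟨9, x⟩) fun x => ⟨10, x⟩)

theorem joinBlocks_bijective (r : ℕ → ℕ) : Function.Bijective (joinBlocks r) := by
  constructor
  · rintro (⟨i, x⟩ | x | x) (⟨j, y⟩ | y | y) h
    all_goals simp only [joinBlocks, Sum.elim_inl, Sum.elim_inr, Sigma.mk.injEq, Fin.ext_iff] at h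
    · obtain ⟨h1, h2⟩ := h
      have : i = j := Fin.ext h1
      subst this
      rw [eq_of_heq h2]
    · exact absurd h.1 (Nat.ne_of_lt i.2)
    · exact absurd h.1 (Nat.ne_of_lt (i.2.trans (by decide)))
    · exact absurd h.1.symm (Nat.ne_of_lt j.2)
    · rw [eq_of_heq h.2]
    · exact absurd h.1 (by decide)
    · exact absurd h.1.symm (Nat.ne_of_lt (j.2.trans (by decide)))
    · exact absurd h.1 (by decide)
    · rw [eq_of_heq h.2]
  · rintro ⟨⟨i, hi⟩, x⟩
    by_cases h9 : i < 9
    · exact ⟨Sum.inl ⟨⟨i, h9⟩, x⟩, rfl⟩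
    · obtain rfl | rfl : i = 9 ∨ i = 10 := by omega
      · exact ⟨Sum.inr (Sum.inl x), rfl⟩
      · exact ⟨Sum.inr (Sum.inr x), rfl⟩

/-- The bijection between the index set of eleven blocks and its splitting. -/
noncomputable def splitBlocks (r : ℕ → ℕ) :
    BlockIdx 11 r ≃ BlockIdx 9 r ⊕ (Fin (r 10) ⊕ Fin (r 11)) :=
  (Equiv.ofBijective _ (joinBlocks_bijective r)).symm

theorem splitBlocks_symm (r : ℕ → ℕ) : ⇑(splitBlocks r).symm = joinBlocks r := rfl

theorem identPattern_eq_submatrix_splitBlocks {r c : ℕ → ℕ} {S : Finset (ℕ × ℕ)}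
    (hS : ∀ p ∈ S, p.1 ≤ 9) :
    identPattern 11 6 r c S =
      (fromRows (identPattern 9 6 r c S) 0).submatrix (splitBlocks r) id := by
  ext1 x y
  obtain ⟨x, rfl⟩ := (splitBlocks r).symm.surjective x
  rw [submatrix_apply, Equiv.apply_symm_apply, splitBlocks_symm]
  rcases x with x | x | x
  · rfl
  · refine if_neg fun h => ?_
    have := hS _ h.1
    simp [joinBlocks] at this
  · refine if_neg fun h => ?_
    have := hS _ h.1
    simp [joinBlocks] at this

/-- Reduction of the corner of a block matrix to its rank normal form, and clearing of the last
block row and column. -/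
theorem exists_corner_reduction {α β : Type} [Fintype α] [DecidableEq α] [Fintype β]
    [DecidableEq β] {k l a b t : ℕ} (S : Matrix (α ⊕ Fin k) (β ⊕ Fin l) ℍ[ℝ])
    (ht : qrank S.toBlocks₂₂ = t) (hk : a + t = k) (hl : b + t = l) :
    ∃ (L : InvMat (α ⊕ Fin k) (α ⊕ (Fin a ⊕ Fin t))) (R : InvMat (β ⊕ (Fin b ⊕ Fin t)) (β ⊕ Fin l))
      (S' : Matrix (α ⊕ (Fin a ⊕ Fin t)) (β ⊕ (Fin b ⊕ Fin t)) ℍ[ℝ]),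
      S = L.val * S' * R.val ∧
      (∀ {γ : Type} (X : Matrix α γ ℍ[ℝ]),
        L.val * fromRows X (0 : Matrix (Fin a ⊕ Fin t) γ ℍ[ℝ]) = fromRows X 0) ∧
      (∀ {γ : Type} (X : Matrix γ β ℍ[ℝ]),
        fromCols X (0 : Matrix γ (Fin b ⊕ Fin t) ℍ[ℝ]) * R.val = fromCols X 0) ∧
      S'.toBlocks₂₂ = fromBlocks 0 0 0 1 ∧
      (∀ x y, S' (Sum.inl x) (Sum.inr (Sum.inr y)) = 0) ∧
      (∀ x y, S' (Sum.inr (Sum.inr x)) (Sum.inl y) = 0) := by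
  obtain ⟨P, Q, hPQ⟩ := exists_rank_normal_form S.toBlocks₂₂ ht (a := a) (b := b)
    (by simp [hk]) (by simp [hl])
  set J : Matrix (Fin a ⊕ Fin t) (Fin b ⊕ Fin t) ℍ[ℝ] := fromBlocks 0 0 0 1 with hJ
  let x := S.toBlocks₁₂ * Q.inv
  let z := P.inv * S.toBlocks₂₁
  -- `J` has its identity only in the last `t` places, so only the last columns of `x` and the last
  -- rows of `z` can, and need to, be cleared.
  let N : Matrix α (Fin a ⊕ Fin t) ℍ[ℝ] := fromCols 0 x.toCols₂
  let N' : Matrix (Fin b ⊕ Fin t) β ℍ[ℝ] := fromRows 0 z.toRows₂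
  have hNJ : N * J = fromCols 0 x.toCols₂ := by
    simp only [N, hJ, fromCols_mul_fromBlocks]
    simp
  have hJN : J * N' = fromRows 0 z.toRows₂ := by
    simp only [N', hJ, fromBlocks_mul_fromRows]
    simp
  let S' : Matrix (α ⊕ (Fin a ⊕ Fin t)) (β ⊕ (Fin b ⊕ Fin t)) ℍ[ℝ] :=
    fromBlocks (S.toBlocks₁₁ - N * (z - J * N') - x * N') (x - N * J) (z - J * N') J
  refine ⟨(InvMat.oneDiag α P).mul (InvMat.upper N), (InvMat.lower N').mul (InvMat.oneDiag β Q), S',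
    ?_, ?_, ?_, ?_, ?_, ?_⟩
  · simp only [InvMat.mul, InvMat.oneDiag, InvMat.upper, InvMat.lower, S', fromBlocks_multiply,
      Matrix.mul_zero, Matrix.zero_mul, Matrix.one_mul, Matrix.mul_one, add_zero, zero_add]
    conv_lhs => rw [← fromBlocks_toBlocks S]
    congr 1
    · simp only [Matrix.sub_mul, Matrix.add_mul]
      abel
    · simp [x]
    · simp [z, Matrix.mul_sub, Matrix.mul_assoc]
  -- The left factor is block upper triangular with identity in its upper left block, so it fixes
  -- whatever is supported in the upper rows; dually for the right factor. This is what preserves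
  -- the patterns.
  · intro γ X
    change (fromBlocks 1 0 0 P.val : Matrix (α ⊕ Fin k) (α ⊕ (Fin a ⊕ Fin t)) ℍ[ℝ]) *
      (fromBlocks 1 N 0 1 : Matrix (α ⊕ (Fin a ⊕ Fin t)) (α ⊕ (Fin a ⊕ Fin t)) ℍ[ℝ]) *
      fromRows X (0 : Matrix (Fin a ⊕ Fin t) γ ℍ[ℝ]) = fromRows X 0
    rw [Matrix.mul_assoc, fromBlocks_mul_fromRows, fromBlocks_mul_fromRows]
    simp
  · intro γ X
    change fromCols X (0 : Matrix γ (Fin b ⊕ Fin t) ℍ[ℝ]) *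
      ((fromBlocks 1 0 N' 1 : Matrix (β ⊕ (Fin b ⊕ Fin t)) (β ⊕ (Fin b ⊕ Fin t)) ℍ[ℝ]) *
      (fromBlocks 1 0 0 Q.val : Matrix (β ⊕ (Fin b ⊕ Fin t)) (β ⊕ Fin l) ℍ[ℝ])) = fromCols X 0
    rw [← Matrix.mul_assoc, fromCols_mul_fromBlocks, fromCols_mul_fromBlocks]
    simp
  · rfl
  · intro i j
    change (x - N * J) i (Sum.inr j) = 0
    rw [hNJ]
    exact sub_self _
  · intro i j
    change (z - J * N') (Sum.inr i) j = 0
    rw [hJN]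
    exact sub_self _

theorem card_blockIdx_rowSizes (s : ℕ → ℕ) (a b : ℕ) :
    Fintype.card (BlockIdx 9 (rowSizes s a b)) =
      s 1 + s 2 + s 3 + s 4 + s 5 + s 4 + s 6 + s 7 + s 8 := by
  rw [Fintype.card_sigma]
  simp only [Fin.sum_univ_succ, Fintype.card_fin, Fin.sum_univ_zero]
  change s 1 + (s 2 + (s 3 + (s 4 + (s 5 + (s 4 + (s 6 + (s 7 + (s 8 + 0)))))))) = _
  omega

theorem eq_of_conjTranspose_eq_mul {ι κ μ ν : Type} [Fintype μ] [Fintype ν]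
    {E : Matrix ι κ ℍ[ℝ]} {P : Matrix κ μ ℍ[ℝ]} {S : Matrix μ ν ℍ[ℝ]} {T : Matrix ν ι ℍ[ℝ]}
    (h : Eᴴ = P * S * T) : E = Tᴴ * Sᴴ * Pᴴ := by
  rw [← conjTranspose_conjTranspose E, h, conjTranspose_mul, conjTranspose_mul, Matrix.mul_assoc]

/-- Since `L` fixes the padded pattern, it can be absorbed into `P` without disturbing the normal
forms of `B`, `C`, `D`. -/
theorem padPattern_eq_mul {k : ℕ} {r c : ℕ → ℕ} {S : Finset (ℕ × ℕ)} (hS : ∀ p ∈ S, p.1 ≤ 9)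
    (L : InvMat (BlockIdx 9 r ⊕ Fin k) (BlockIdx 9 r ⊕ (Fin (r 10) ⊕ Fin (r 11))))
    (hL : ∀ {γ : Type} (X : Matrix (BlockIdx 9 r) γ ℍ[ℝ]),
      L.val * fromRows X (0 : Matrix (Fin (r 10) ⊕ Fin (r 11)) γ ℍ[ℝ]) = fromRows X 0) :
    padPattern k r c S =
      (L.reindex (Equiv.refl _) (splitBlocks r)).val * identPattern 11 6 r c S := by
  rw [identPattern_eq_submatrix_splitBlocks hS, padPattern, ← hL]
  rw [InvMat.reindex_val, Matrix.submatrix_mul_equiv]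
  rfl

theorem padPattern_conjTranspose_eq_mul {k : ℕ} {r c : ℕ → ℕ} {S : Finset (ℕ × ℕ)}
    (hS : ∀ p ∈ S, p.1 ≤ 9)
    (R : InvMat (BlockIdx 9 r ⊕ (Fin (r 10) ⊕ Fin (r 11))) (BlockIdx 9 r ⊕ Fin k))
    (hR : ∀ {γ : Type} (X : Matrix γ (BlockIdx 9 r) ℍ[ℝ]),
      fromCols X (0 : Matrix γ (Fin (r 10) ⊕ Fin (r 11)) ℍ[ℝ]) * R.val = fromCols X 0) :
    (padPattern k r c S)ᴴ =
      (identPattern 11 6 r c S)ᴴ * (R.reindex (splitBlocks r) (Equiv.refl _)).val := by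
  have h := padPattern_eq_mul (k := k) (c := c) hS R.conjTranspose fun {γ} X => by
    have := congrArg Matrix.conjTranspose (hR Xᴴ)
    rwa [conjTranspose_mul, conjTranspose_fromCols_eq_fromRows_conjTranspose,
      conjTranspose_fromCols_eq_fromRows_conjTranspose, conjTranspose_conjTranspose,
      conjTranspose_zero, conjTranspose_zero] at this
  have h2 := congrArg Matrix.conjTranspose h
  rw [conjTranspose_mul] at h2
  rw [h2]
  congr 1
  ext1 i j
  exact star_star _

/-! ### The decomposition of the given array -/

namespace QArray

variable {m n p₁ p₂ p₃ q₁ q₂ q₃ : ℕ} (K : QArray m n p₁ p₂ p₃ q₁ q₂ q₃)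

theorem tripleDims_rows : TripleDims (colSpan K.B) (colSpan K.C) (colSpan K.D) K.ms := by
  have h : K.rdb0_d0c = qrank (fromCols (fromRows K.D K.D) (fromCols (fromRows K.B 0)
      (fromRows 0 K.C))) := by
    rw [rdb0_d0c]
    congr 1
    ext1 i j
    rcases i with i | i <;> rcases j with j | j | j <;> rfl
  have hsup : colSpan K.B ⊔ colSpan K.C ⊔ colSpan K.D =
      colSpan (fromCols K.B (fromCols K.C K.D)) := by
    rw [colSpan_fromCols, colSpan_fromCols, sup_assoc]
  refine tripleDims_of_finrank (r := K.rdb0_d0c) _ _ _ (d₁ := K.rb) (d₂ := K.rc) (d₃ := K.rd)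
    (d₁₂ := K.rbc) (d₁₃ := K.rbd) (d₂₃ := K.rcd) (d := K.rbcd) rfl rfl rfl ?_ ?_ ?_ ?_ ?_
    rfl rfl rfl rfl rfl rfl rfl rfl
  · rw [← colSpan_fromCols]; rfl
  · rw [← colSpan_fromCols]; rfl
  · rw [← colSpan_fromCols]; rfl
  · rw [hsup]; rfl
  · rw [h]
    exact qrank_triple_add_finrank_inf _ _ _

theorem tripleDims_cols : TripleDims (colSpan K.Eᴴ) (colSpan K.Fᴴ) (colSpan K.Gᴴ) K.ns := by
  have h : K.rgg_e0_0f = qrank (fromCols (fromRows K.Gᴴ K.Gᴴ) (fromCols (fromRows K.Eᴴ 0)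
      (fromRows 0 K.Fᴴ))) := by
    rw [rgg_e0_0f, ← qrank_conjTranspose]
    congr 1
    ext1 i j
    rcases i with i | i <;> rcases j with j | j | j <;> simp
  have hsup : colSpan K.Eᴴ ⊔ colSpan K.Fᴴ ⊔ colSpan K.Gᴴ =
      colSpan (fromRows K.E (fromRows K.F K.G))ᴴ := by
    rw [conjTranspose_fromRows_eq_fromCols_conjTranspose,
      conjTranspose_fromRows_eq_fromCols_conjTranspose, colSpan_fromCols, colSpan_fromCols,
      sup_assoc]
  refine tripleDims_of_finrank (r := K.rgg_e0_0f) _ _ _ (d₁ := K.re) (d₂ := K.rf) (d₃ := K.rg)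
    (d₁₂ := K.re_f) (d₁₃ := K.re_g) (d₂₃ := K.rf_g) (d := K.re_f_g)
    (qrank_conjTranspose _) (qrank_conjTranspose _) (qrank_conjTranspose _) ?_ ?_ ?_ ?_ ?_
    rfl rfl rfl rfl rfl rfl rfl rfl
  · rw [← colSpan_fromCols, ← conjTranspose_fromRows_eq_fromCols_conjTranspose]
    exact qrank_conjTranspose _
  · rw [← colSpan_fromCols, ← conjTranspose_fromRows_eq_fromCols_conjTranspose]
    exact qrank_conjTranspose _
  · rw [← colSpan_fromCols, ← conjTranspose_fromRows_eq_fromCols_conjTranspose]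
    exact qrank_conjTranspose _
  · rw [hsup]
    exact qrank_conjTranspose _
  · rw [h]
    have h2 := qrank_triple_add_finrank_inf K.Eᴴ K.Fᴴ K.Gᴴ
    rw [qrank_conjTranspose K.E, qrank_conjTranspose K.F, qrank_conjTranspose K.G] at h2
    exact h2

theorem rabcd_e_f_g_eq : K.rabcd_e_f_g = qrank (fromBlocks K.A
    (fromCols K.B (fromCols K.C K.D)) (fromRows K.E (fromRows K.F K.G)) 0) := by
  rw [rabcd_e_f_g]
  congr 1
  ext1 i j
  rcases i with i | i | i | i <;> rcases j with j | j | j | j <;> rfl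

/-- Normal forms of the two triples, together with the splitting of the rank of the array. -/
theorem exists_outer_form :
    ∃ (k l : ℕ) (P : InvMat (Fin m) (BlockIdx 9 K.rowSize ⊕ Fin k))
      (Q : InvMat (BlockIdx 9 K.colSize ⊕ Fin l) (Fin n))
      (T₁ : InvMat (BlockIdx 6 K.xRow) (Fin p₁)) (T₂ : InvMat (BlockIdx 6 K.yRow) (Fin p₂))
      (T₃ : InvMat (BlockIdx 6 K.zRow) (Fin p₃)) (V₁ : InvMat (Fin q₁) (BlockIdx 6 K.xCol))
      (V₂ : InvMat (Fin q₂) (BlockIdx 6 K.yCol)) (V₃ : InvMat (Fin q₃) (BlockIdx 6 K.zCol)),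
      K.rbcd + k = m ∧ K.re_f_g + l = n ∧
      K.rabcd_e_f_g = K.rbcd + K.re_f_g + qrank (P.inv * K.A * Q.inv).toBlocks₂₂ ∧
      K.B = P.val * padPattern k K.rowSize K.xRow patB * T₁.val ∧
      K.C = P.val * padPattern k K.rowSize K.yRow patC * T₂.val ∧
      K.D = P.val * padPattern k K.rowSize K.zRow patD * T₃.val ∧
      K.E = V₁.val * (padPattern l K.colSize K.xCol patB)ᴴ * Q.val ∧
      K.F = V₂.val * (padPattern l K.colSize K.yCol patC)ᴴ * Q.val ∧
      K.G = V₃.val * (padPattern l K.colSize K.zCol patD)ᴴ * Q.val := by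
  have hN : colSpan K.B ⊔ colSpan K.C ⊔ colSpan K.D =
      colSpan (fromCols K.B (fromCols K.C K.D)) := by
    rw [colSpan_fromCols, colSpan_fromCols, sup_assoc]
  have hM : colSpan K.Eᴴ ⊔ colSpan K.Fᴴ ⊔ colSpan K.Gᴴ =
      colSpan (fromRows K.E (fromRows K.F K.G))ᴴ := by
    rw [conjTranspose_fromRows_eq_fromCols_conjTranspose,
      conjTranspose_fromRows_eq_fromCols_conjTranspose, colSpan_fromCols, colSpan_fromCols,
      sup_assoc]
  have hrk : Module.finrank (ℍ[ℝ])ᵐᵒᵖ ↥(colSpan K.B ⊔ colSpan K.C ⊔ colSpan K.D) = K.rbcd := by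
    rw [hN]; rfl
  have hck : Module.finrank (ℍ[ℝ])ᵐᵒᵖ ↥(colSpan K.Eᴴ ⊔ colSpan K.Fᴴ ⊔ colSpan K.Gᴴ) =
      K.re_f_g := by
    rw [hM]
    exact qrank_conjTranspose _
  have hkm : K.rbcd ≤ m := by
    have := Submodule.finrank_le (colSpan K.B ⊔ colSpan K.C ⊔ colSpan K.D)
    rwa [hrk, finrank_quaternion_fun, Fintype.card_fin] at this
  have hln : K.re_f_g ≤ n := by
    have := Submodule.finrank_le (colSpan K.Eᴴ ⊔ colSpan K.Fᴴ ⊔ colSpan K.Gᴴ)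
    rwa [hck, finrank_quaternion_fun, Fintype.card_fin] at this
  -- The sizes of blocks 10 and 11 do not affect nine blocks; they are supplied so that `rowSizes`
  -- unfolds to `K.rowSize`.
  obtain ⟨P, T₁, T₂, T₃, hB, hC, hD, hP⟩ := exists_triple_form K.B K.C K.D K.tripleDims_rows
    (m - (K.rbcd + K.t)) K.t rfl rfl rfl hrk (Nat.add_sub_of_le hkm)
  obtain ⟨Q, V₁, V₂, V₃, hE, hF, hG, hQ⟩ := exists_triple_form K.Eᴴ K.Fᴴ K.Gᴴ K.tripleDims_cols
    (n - (K.re_f_g + K.t)) K.t (qrank_conjTranspose _) (qrank_conjTranspose _)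
    (qrank_conjTranspose _) hck (Nat.add_sub_of_le hln)
  refine ⟨_, _, P, Q.conjTranspose, T₁, T₂, T₃, V₁.conjTranspose, V₂.conjTranspose,
    V₃.conjTranspose, Nat.add_sub_of_le hkm, Nat.add_sub_of_le hln, ?_, hB, hC, hD, ?_, ?_, ?_⟩
  · have h := qrank_bordered K.A (fromCols K.B (fromCols K.C K.D))
      (fromRows K.E (fromRows K.F K.G)) P Q.conjTranspose (hP.trans hN)
      ((congrArg (fun M => colSpan (Matrix.submatrix M id Sum.inl))
        (conjTranspose_conjTranspose Q.val)).trans (hQ.trans hM))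
    rw [rabcd_e_f_g_eq, h, card_blockIdx_rowSizes, card_blockIdx_rowSizes,
      ← K.tripleDims_rows.sup₁₂₃, ← K.tripleDims_cols.sup₁₂₃, hrk, hck]
    rfl
  · exact eq_of_conjTranspose_eq_mul hE
  · exact eq_of_conjTranspose_eq_mul hF
  · exact eq_of_conjTranspose_eq_mul hG

/-- The outer forms already fix `B`, …, `G`. The factors reducing the corner of `P⁻¹ A Q⁻¹`, which
has rank `t`, are then absorbed into `P` and `Q`. -/
theorem nonempty_decomposition : Nonempty K.Decomposition := by
  obtain ⟨k, l, P, Q, T₁, T₂, T₃, V₁, V₂, V₃, hk, hl, hA, hB, hC, hD, hE, hF, hG⟩ :=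
    K.exists_outer_form
  have ht : qrank (P.inv * K.A * Q.inv).toBlocks₂₂ = K.t := by
    rw [t, hA]
    omega
  have htl : K.t ≤ l := by
    rw [← ht]
    simpa using qrank_le_card (P.inv * K.A * Q.inv).toBlocks₂₂
  have htk : K.t ≤ k := by
    rw [← ht, ← qrank_conjTranspose]
    simpa using qrank_le_card (P.inv * K.A * Q.inv).toBlocks₂₂ᴴ
  obtain ⟨L, R, S, hS, hL, hR, h22, h12, h21⟩ := exists_corner_reduction (P.inv * K.A * Q.inv) ht
    (a := m - (K.rbcd + K.t)) (b := n - (K.re_f_g + K.t)) (by omega) (by omega)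
  have hBr : ∀ p ∈ patB, p.1 ≤ 9 := by decide
  have hCr : ∀ p ∈ patC, p.1 ≤ 9 := by decide
  have hDr : ∀ p ∈ patD, p.1 ≤ 9 := by decide
  let eR := splitBlocks K.rowSize
  let eC := splitBlocks K.colSize
  let S₁ : Matrix (BlockIdx 11 K.rowSize) (BlockIdx 11 K.colSize) ℍ[ℝ] := S.submatrix eR eC
  have hS₁ : ∀ x y, S₁ (eR.symm x) (eC.symm y) = S x y := fun x y => by
    change S (eR (eR.symm x)) (eC (eC.symm y)) = S x y
    rw [Equiv.apply_symm_apply, Equiv.apply_symm_apply]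
  -- Indices in `Fin 11` start at 0, so `10` is the block labelled 11.
  have hcol : ∀ i : Fin 11, i ≠ 10 → ∀ x y, S₁ ⟨i, x⟩ ⟨10, y⟩ = 0 := by
    intro i hi x y
    obtain ⟨z, hz⟩ := eR.symm.surjective ⟨i, x⟩
    have h := hS₁ z (Sum.inr (Sum.inr y))
    rw [hz] at h
    refine h.trans ?_
    rcases z with z | z | z
    · exact h12 _ _
    · exact congrFun (congrFun h22 (Sum.inl z)) (Sum.inr y)
    · exact absurd (congrArg Sigma.fst hz).symm hi
  have hrow : ∀ j : Fin 11, j ≠ 10 → ∀ x y, S₁ ⟨10, x⟩ ⟨j, y⟩ = 0 := by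
    intro j hj x y
    obtain ⟨z, hz⟩ := eC.symm.surjective ⟨j, y⟩
    have h := hS₁ (Sum.inr (Sum.inr x)) z
    rw [hz] at h
    refine h.trans ?_
    rcases z with z | z | z
    · exact h21 _ _
    · exact congrFun (congrFun h22 (Sum.inr x)) (Sum.inl z)
    · exact absurd (congrArg Sigma.fst hz).symm hj
  let Lr := L.reindex (Equiv.refl _) eR
  let Rr := R.reindex eC (Equiv.refl _)
  have hLR : P.inv * K.A * Q.inv = Lr.val * S₁ * Rr.val := by
    rw [hS]
    exact (InvMat.reindex_mul_submatrix_mul_reindex L R S eR eC).symm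
  refine ⟨{
    P := P.mul Lr
    Q := Rr.mul Q
    T₁ := T₁
    T₂ := T₂
    T₃ := T₃
    V₁ := V₁
    V₂ := V₂
    V₃ := V₃
    blk := blocksOf S₁
    blk_ten_ten := ?_
    blk_last := ?_
    blk_last_col := ?_
    blk_last_row := ?_
    hA := ?_
    hB := ?_
    hC := ?_
    hD := ?_
    hE := ?_
    hF := ?_
    hG := ?_ }⟩
  · ext1 x y
    have h : blocksOf S₁ 10 10 x y = S₁ ⟨9, x⟩ ⟨9, y⟩ :=
      blocksOf_succ S₁ (i := 9) (j := 9) (by decide) (by decide) x y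
    exact (h.trans (hS₁ (Sum.inr (Sum.inl x)) (Sum.inr (Sum.inl y)))).trans
        (congrFun (congrFun h22 (Sum.inl x)) (Sum.inl y))
  · ext1 x y
    have h : blocksOf S₁ 11 11 x y = S₁ ⟨10, x⟩ ⟨10, y⟩ :=
      blocksOf_succ S₁ (i := 10) (j := 10) (by decide) (by decide) x y
    exact (h.trans (hS₁ (Sum.inr (Sum.inr x)) (Sum.inr (Sum.inr y)))).trans
        (congrFun (congrFun h22 (Sum.inr x)) (Sum.inr y))
  · rintro (_ | i) hi
    · rfl
    · ext1 x y
      by_cases h : i < 11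
      · exact (dif_pos ⟨h, by decide⟩).trans (hcol ⟨i, h⟩ (by simpa [Fin.ext_iff] using hi) x y)
      · exact dif_neg fun h' => h h'.1
  · rintro (_ | j) hj
    · rfl
    · ext1 x y
      by_cases h : j < 11
      · exact (dif_pos ⟨by decide, h⟩).trans (hrow ⟨j, h⟩ (by simpa [Fin.ext_iff] using hj) x y)
      · exact dif_neg fun h' => h h'.2
  · rw [blockMat_blocksOf]
    change K.A = P.val * Lr.val * S₁ * (Rr.val * Q.val)
    calc K.A = P.val * (P.inv * K.A * Q.inv) * Q.val := by
          rw [← Matrix.mul_assoc, ← Matrix.mul_assoc, P.val_mul_inv, Matrix.one_mul,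
            Q.mul_inv_mul_val]
      _ = _ := by rw [hLR]; simp only [Matrix.mul_assoc]
  · rw [hB, padPattern_eq_mul hBr L hL]
    simp only [InvMat.mul, Matrix.mul_assoc]
    rfl
  · rw [hC, padPattern_eq_mul hCr L hL]
    simp only [InvMat.mul, Matrix.mul_assoc]
    rfl
  · rw [hD, padPattern_eq_mul hDr L hL]
    simp only [InvMat.mul, Matrix.mul_assoc]
    rfl
  · rw [hE, padPattern_conjTranspose_eq_mul hBr R hR]
    simp only [InvMat.mul, Matrix.mul_assoc]
    rfl
  · rw [hF, padPattern_conjTranspose_eq_mul hCr R hR]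
    simp only [InvMat.mul, Matrix.mul_assoc]
    rfl
  · rw [hG, padPattern_conjTranspose_eq_mul hDr R hR]
    simp only [InvMat.mul, Matrix.mul_assoc]
    rfl

end QArray

/-! ### The block equations -/

theorem mul_identPattern_conjTranspose_apply {ι : Type} {k l : ℕ} {r c : ℕ → ℕ}
    (S : Finset (ℕ × ℕ)) (M : Matrix ι (BlockIdx l c) ℍ[ℝ]) (x : ι) (y : BlockIdx k r) :
    (M * (identPattern k l r c S)ᴴ) x y = ∑ j : Fin l, if (y.1.val + 1, j.val + 1) ∈ S then
      (if h : y.2.val < c (j.val + 1) then M x ⟨j, y.2.val, h⟩ else 0) else 0 := by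
  have h : (M * (identPattern k l r c S)ᴴ) x y = star ((identPattern k l r c S * Mᴴ) y x) := by
    rw [← conjTranspose_apply, conjTranspose_mul, conjTranspose_conjTranspose]
  rw [h, identPattern_mul_apply, star_sum]
  refine Finset.sum_congr rfl fun j _ => ?_
  split_ifs <;> simp

section Expansion

variable {s r c : ℕ → ℕ} {a b k : ℕ}

/-- The block rows of `S_B X`. -/
noncomputable def rowsB (X : ∀ i j, Matrix (Fin (sizesB s k i)) (Fin (c j)) ℍ[ℝ]) :
    ∀ i j, Matrix (Fin (rowSizes s a b i)) (Fin (c j)) ℍ[ℝ]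
  | 1, j => X 1 j
  | 2, j => X 2 j
  | 3, j => X 3 j
  | 4, j => X 4 j
  | 5, j => X 5 j
  | _, _ => 0

/-- The block columns of `X S_Bᴴ`. -/
noncomputable def colsB (X : ∀ i j, Matrix (Fin (r i)) (Fin (sizesB s k j)) ℍ[ℝ]) :
    ∀ i j, Matrix (Fin (r i)) (Fin (rowSizes s a b j)) ℍ[ℝ]
  | i, 1 => X i 1
  | i, 2 => X i 2
  | i, 3 => X i 3
  | i, 4 => X i 4
  | i, 5 => X i 5
  | _, _ => 0

/-- The block rows of `S_C X`. -/
noncomputable def rowsC (X : ∀ i j, Matrix (Fin (sizesC s k i)) (Fin (c j)) ℍ[ℝ]) :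
    ∀ i j, Matrix (Fin (rowSizes s a b i)) (Fin (c j)) ℍ[ℝ]
  | 1, j => X 4 j
  | 2, j => X 5 j
  | 6, j => X 1 j
  | 7, j => X 2 j
  | 8, j => X 3 j
  | _, _ => 0

/-- The block columns of `X S_Cᴴ`. -/
noncomputable def colsC (X : ∀ i j, Matrix (Fin (r i)) (Fin (sizesC s k j)) ℍ[ℝ]) :
    ∀ i j, Matrix (Fin (r i)) (Fin (rowSizes s a b j)) ℍ[ℝ]
  | i, 1 => X i 4
  | i, 2 => X i 5
  | i, 6 => X i 1
  | i, 7 => X i 2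
  | i, 8 => X i 3
  | _, _ => 0

/-- The block rows of `S_D X`. -/
noncomputable def rowsD (X : ∀ i j, Matrix (Fin (sizesD s k i)) (Fin (c j)) ℍ[ℝ]) :
    ∀ i j, Matrix (Fin (rowSizes s a b i)) (Fin (c j)) ℍ[ℝ]
  | 1, j => X 5 j
  | 3, j => X 4 j
  | 4, j => X 2 j
  | 6, j => X 2 j
  | 7, j => X 3 j
  | 9, j => X 1 j
  | _, _ => 0

/-- The block columns of `X S_Dᴴ`. -/
noncomputable def colsD (X : ∀ i j, Matrix (Fin (r i)) (Fin (sizesD s k j)) ℍ[ℝ]) :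
    ∀ i j, Matrix (Fin (r i)) (Fin (rowSizes s a b j)) ℍ[ℝ]
  | i, 1 => X i 5
  | i, 3 => X i 4
  | i, 4 => X i 2
  | i, 6 => X i 2
  | i, 7 => X i 3
  | i, 9 => X i 1
  | _, _ => 0

theorem identPattern_patB_mul {l : ℕ}
    (X : ∀ i j, Matrix (Fin (sizesB s k i)) (Fin (c j)) ℍ[ℝ]) :
    identPattern 11 6 (rowSizes s a b) (sizesB s k) patB * blockMat 6 l X =
      blockMat 11 l (rowsB X) := by
  ext1 ⟨i, x⟩ ⟨j, y⟩
  rw [identPattern_mul_apply]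
  fin_cases i <;> simp [Fin.sum_univ_succ, patB]
  all_goals first | rfl | (rw [dif_pos (by exact x.2)]; rfl)

theorem mul_identPattern_patB_conjTranspose {l : ℕ}
    (X : ∀ i j, Matrix (Fin (r i)) (Fin (sizesB s k j)) ℍ[ℝ]) :
    blockMat l 6 X * (identPattern 11 6 (rowSizes s a b) (sizesB s k) patB)ᴴ =
      blockMat l 11 (colsB X) := by
  ext1 ⟨i, x⟩ ⟨j, y⟩
  rw [mul_identPattern_conjTranspose_apply]
  fin_cases j <;> simp [Fin.sum_univ_succ, patB]
  all_goals first | rfl | (rw [dif_pos (by exact y.2)]; rfl)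

theorem identPattern_patC_mul {l : ℕ}
    (X : ∀ i j, Matrix (Fin (sizesC s k i)) (Fin (c j)) ℍ[ℝ]) :
    identPattern 11 6 (rowSizes s a b) (sizesC s k) patC * blockMat 6 l X =
      blockMat 11 l (rowsC X) := by
  ext1 ⟨i, x⟩ ⟨j, y⟩
  rw [identPattern_mul_apply]
  fin_cases i <;> simp [Fin.sum_univ_succ, patC]
  all_goals first | rfl | (rw [dif_pos (by exact x.2)]; rfl)

theorem mul_identPattern_patC_conjTranspose {l : ℕ}
    (X : ∀ i j, Matrix (Fin (r i)) (Fin (sizesC s k j)) ℍ[ℝ]) :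
    blockMat l 6 X * (identPattern 11 6 (rowSizes s a b) (sizesC s k) patC)ᴴ =
      blockMat l 11 (colsC X) := by
  ext1 ⟨i, x⟩ ⟨j, y⟩
  rw [mul_identPattern_conjTranspose_apply]
  fin_cases j <;> simp [Fin.sum_univ_succ, patC]
  all_goals first | rfl | (rw [dif_pos (by exact y.2)]; rfl)

theorem identPattern_patD_mul {l : ℕ}
    (X : ∀ i j, Matrix (Fin (sizesD s k i)) (Fin (c j)) ℍ[ℝ]) :
    identPattern 11 6 (rowSizes s a b) (sizesD s k) patD * blockMat 6 l X =
      blockMat 11 l (rowsD X) := by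
  ext1 ⟨i, x⟩ ⟨j, y⟩
  rw [identPattern_mul_apply]
  fin_cases i <;> simp [Fin.sum_univ_succ, patD]
  all_goals first | rfl | (rw [dif_pos (by exact x.2)]; rfl)

theorem mul_identPattern_patD_conjTranspose {l : ℕ}
    (X : ∀ i j, Matrix (Fin (r i)) (Fin (sizesD s k j)) ℍ[ℝ]) :
    blockMat l 6 X * (identPattern 11 6 (rowSizes s a b) (sizesD s k) patD)ᴴ =
      blockMat l 11 (colsD X) := by
  ext1 ⟨i, x⟩ ⟨j, y⟩
  rw [mul_identPattern_conjTranspose_apply]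
  fin_cases j <;> simp [Fin.sum_univ_succ, patD]
  all_goals first | rfl | (rw [dif_pos (by exact y.2)]; rfl)

theorem blockMat_colsB_rowsB {s' : ℕ → ℕ} {a' b' k' : ℕ}
    (X : ∀ i j, Matrix (Fin (sizesB s k i)) (Fin (sizesB s' k' j)) ℍ[ℝ]) :
    blockMat 11 11 (colsB (a := a') (b := b') (rowsB (a := a) (b := b) X)) =
      identPattern 11 6 (rowSizes s a b) (sizesB s k) patB * blockMat 6 6 X *
        (identPattern 11 6 (rowSizes s' a' b') (sizesB s' k') patB)ᴴ := by
  rw [identPattern_patB_mul, mul_identPattern_patB_conjTranspose]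

theorem blockMat_colsC_rowsC {s' : ℕ → ℕ} {a' b' k' : ℕ}
    (X : ∀ i j, Matrix (Fin (sizesC s k i)) (Fin (sizesC s' k' j)) ℍ[ℝ]) :
    blockMat 11 11 (colsC (a := a') (b := b') (rowsC (a := a) (b := b) X)) =
      identPattern 11 6 (rowSizes s a b) (sizesC s k) patC * blockMat 6 6 X *
        (identPattern 11 6 (rowSizes s' a' b') (sizesC s' k') patC)ᴴ := by
  rw [identPattern_patC_mul, mul_identPattern_patC_conjTranspose]

theorem blockMat_colsD_rowsD {s' : ℕ → ℕ} {a' b' k' : ℕ}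
    (X : ∀ i j, Matrix (Fin (sizesD s k i)) (Fin (sizesD s' k' j)) ℍ[ℝ]) :
    blockMat 11 11 (colsD (a := a') (b := b') (rowsD (a := a) (b := b) X)) =
      identPattern 11 6 (rowSizes s a b) (sizesD s k) patD * blockMat 6 6 X *
        (identPattern 11 6 (rowSizes s' a' b') (sizesD s' k') patD)ᴴ := by
  rw [identPattern_patD_mul, mul_identPattern_patD_conjTranspose]

end Expansion

theorem blockMat_inj {k l : ℕ} {r c : ℕ → ℕ} {M N : ∀ i j, Matrix (Fin (r i)) (Fin (c j)) ℍ[ℝ]} :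
    blockMat k l M = blockMat k l N ↔ ∀ i < k, ∀ j < l, M (i + 1) (j + 1) = N (i + 1) (j + 1) := by
  constructor
  · intro h i hi j hj
    ext1 x y
    exact congrFun (congrFun h ⟨⟨i, hi⟩, x⟩) ⟨⟨j, hj⟩, y⟩
  · intro h
    ext1 ⟨i, x⟩ ⟨j, y⟩
    exact congrFun (congrFun (h i i.2 j j.2) x) y

/-! ### The reduced equation, solved block by block -/

namespace QArray.Decomposition

variable {m n p₁ p₂ p₃ q₁ q₂ q₃ : ℕ} {K : QArray m n p₁ p₂ p₃ q₁ q₂ q₃}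

/-- The blocks of `S_B X S_E + S_C Y S_F + S_D Z S_G`. -/
noncomputable def lhsBlocks (X : K.XBlocks) (Y : K.YBlocks) (Z : K.ZBlocks) (i j : ℕ) :
    Matrix (Fin (K.rowSize i)) (Fin (K.colSize j)) ℍ[ℝ] :=
  colsB (s := K.ns) (a := n - (K.re_f_g + K.t)) (b := K.t) (k := q₁ - K.re)
      (rowsB (s := K.ms) (a := m - (K.rbcd + K.t)) (b := K.t) (k := p₁ - K.rb) X) i j +
    colsC (s := K.ns) (a := n - (K.re_f_g + K.t)) (b := K.t) (k := q₂ - K.rf)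
      (rowsC (s := K.ms) (a := m - (K.rbcd + K.t)) (b := K.t) (k := p₂ - K.rc) Y) i j +
    colsD (s := K.ns) (a := n - (K.re_f_g + K.t)) (b := K.t) (k := q₃ - K.rg)
      (rowsD (s := K.ms) (a := m - (K.rbcd + K.t)) (b := K.t) (k := p₃ - K.rd) Z) i j

theorem blockMat_lhsBlocks (X : K.XBlocks) (Y : K.YBlocks) (Z : K.ZBlocks) :
    blockMat 11 11 (lhsBlocks X Y Z) =
      identPattern 11 6 K.rowSize K.xRow patB * blockMat 6 6 X *
          (identPattern 11 6 K.colSize K.xCol patB)ᴴ +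
        identPattern 11 6 K.rowSize K.yRow patC * blockMat 6 6 Y *
          (identPattern 11 6 K.colSize K.yCol patC)ᴴ +
        identPattern 11 6 K.rowSize K.zRow patD * blockMat 6 6 Z *
          (identPattern 11 6 K.colSize K.zCol patD)ᴴ := by
  exact congrArg₂ (· + ·) (congrArg₂ (· + ·) (blockMat_colsB_rowsB X) (blockMat_colsC_rowsC Y))
    (blockMat_colsD_rowsD Z)

/-- `(X, Y, Z)` are the blocks of a solution of the equation in normal form. -/
def SolvesBlocks (d : K.Decomposition) (X : K.XBlocks) (Y : K.YBlocks) (Z : K.ZBlocks) : Prop :=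
  ∀ i < 11, ∀ j < 11, lhsBlocks X Y Z (i + 1) (j + 1) = d.blk (i + 1) (j + 1)

theorem isSolution_iff_solvesBlocks (d : K.Decomposition) {X : K.XBlocks} {Y : K.YBlocks}
    {Z : K.ZBlocks} :
    K.IsSolution (d.T₁.inv * blockMat 6 6 X * d.V₁.inv) (d.T₂.inv * blockMat 6 6 Y * d.V₂.inv)
      (d.T₃.inv * blockMat 6 6 Z * d.V₃.inv) ↔ d.SolvesBlocks X Y Z := by
  have h : K.B * (d.T₁.inv * blockMat 6 6 X * d.V₁.inv) * K.E +
      K.C * (d.T₂.inv * blockMat 6 6 Y * d.V₂.inv) * K.F +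
      K.D * (d.T₃.inv * blockMat 6 6 Z * d.V₃.inv) * K.G =
        d.P.val * blockMat 11 11 (lhsBlocks X Y Z) * d.Q.val := by
    rw [blockMat_lhsBlocks]
    conv_lhs => rw [d.hB, d.hC, d.hD, d.hE, d.hF, d.hG]
    simp only [Matrix.mul_assoc, Matrix.mul_add, Matrix.add_mul, InvMat.val_mul_inv_mul,
      InvMat.inv_mul_val_mul]
  rw [IsSolution, h, d.hA, SolvesBlocks, ← blockMat_inj]
  constructor
  · intro h
    have := congrArg (fun M => d.P.inv * M * d.Q.inv) h
    simpa only [Matrix.mul_assoc, InvMat.inv_mul_val_mul, d.Q.val_mul_inv, Matrix.mul_one] using this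
  · intro h
    rw [h]

/-- Every matrix has the form required by `isSolution_iff_solvesBlocks`, so passing to blocks loses
no solutions. -/
theorem eq_mul_blockMat_blocksOf {p q : ℕ} {r c : ℕ → ℕ} (T : InvMat (BlockIdx 6 r) (Fin p))
    (V : InvMat (Fin q) (BlockIdx 6 c)) (X : Matrix (Fin p) (Fin q) ℍ[ℝ]) :
    X = T.inv * blockMat 6 6 (blocksOf (T.val * X * V.val)) * V.inv := by
  rw [blockMat_blocksOf]
  simp only [Matrix.mul_assoc, InvMat.inv_mul_val_mul, V.val_mul_inv, Matrix.mul_one]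

section BlockArithmetic

variable {a b : ℕ} {x y z u v : Matrix (Fin a) (Fin b) ℍ[ℝ]}

/-- In this section the three summands are the contributions of `X`, `Y`, `Z` (left, middle, right)
to one block of `lhsBlocks`, an absent one being a literal `0`. The shapes match the unfolding of
`lhsBlocks`. The lemmas up to `sub_sub_eq_right` solve for an unknown block; the later ones serve to
verify the block equations or to read off vanishing blocks. -/
theorem eq_of_left (h : x + 0 + 0 = u) : u = x := by rw [← h, add_zero, add_zero]
theorem eq_of_middle (h : 0 + y + 0 = u) : u = y := by rw [← h, add_zero, zero_add]
theorem eq_of_right (h : 0 + 0 + z = u) : u = z := by rw [← h, zero_add, zero_add]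
theorem sub_eq_left (h : x + 0 + z = u) (h' : 0 + 0 + z = v) : u - v = x := by
  rw [← h, ← h']; abel
theorem sub_eq_middle (h : 0 + y + z = u) (h' : 0 + 0 + z = v) : u - v = y := by
  rw [← h, ← h']; abel
theorem sub_add_eq_middle (h : 0 + y + z = u) (h' : x + 0 + z = v) : u - v + x = y := by
  rw [← h, ← h']; abel
theorem sub_left_eq_middle (h : x + y + 0 = u) : u - x = y := by rw [← h]; abel
theorem sub_left_eq_right (h : x + 0 + z = u) : u - x = z := by rw [← h]; abel
theorem sub_middle_eq_right (h : 0 + y + z = u) : u - y = z := by rw [← h]; abel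
theorem sub_sub_eq_right (h : x + y + z = u) : u - x - y = z := by rw [← h]; abel

theorem left_eq : x + 0 + 0 = x := by abel
theorem middle_eq : 0 + y + 0 = y := by abel
theorem right_eq (h : u = z) : 0 + 0 + z = u := by rw [h]; abel
theorem zero_eq (h : u = 0) : (0 : Matrix (Fin a) (Fin b) ℍ[ℝ]) + 0 + 0 = u := by rw [h]; abel
theorem eq_zero_of_zero (h : (0 : Matrix (Fin a) (Fin b) ℍ[ℝ]) + 0 + 0 = u) : u = 0 :=
  eq_of_right h
theorem left_sub_right_eq : u - v + 0 + v = u := by abel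
theorem middle_sub_right_eq : 0 + (u - v) + v = u := by abel
theorem left_right_sub_eq : x + 0 + (u - x) = u := by abel
theorem middle_right_shift_eq : 0 + (u - v + x) + (v - x) = u := by abel
theorem left_middle_sub_eq : x + (u - x) + 0 = u := by abel
theorem middle_right_sub_eq : 0 + y + (u - y) = u := by abel
theorem right_sub_sub_eq : x + y + (u - x - y) = u := by abel

end BlockArithmetic

variable {d : K.Decomposition} {X : K.XBlocks} {Y : K.YBlocks} {Z : K.ZBlocks}

theorem SolvesBlocks.eq (h : d.SolvesBlocks X Y Z) (i j : ℕ) (hi : 1 ≤ i ∧ i ≤ 11 := by decide)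
    (hj : 1 ≤ j ∧ j ≤ 11 := by decide) : lhsBlocks X Y Z i j = d.blk i j := by
  obtain ⟨i, rfl⟩ := Nat.exists_eq_add_of_le' hi.1
  obtain ⟨j, rfl⟩ := Nat.exists_eq_add_of_le' hj.1
  exact h i (by omega) j (by omega)

/-- The blocks of a solution serve as its own parameters: the prescribed entries hold automatically,
so every solution has the parametrised form. The same principle applies to `Y` and `Z`. -/
theorem SolvesBlocks.xHat_eq (h : d.SolvesBlocks X Y Z) : d.xHat X = X := by
  funext i j
  apply xHat.fun_cases_unfolding d X fun i j M => M = X i j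
  · exact eq_of_left (h.eq 1 5)
  · exact eq_of_left (h.eq 2 3)
  · exact eq_of_left (h.eq 2 4)
  · exact eq_of_left (h.eq 2 5)
  · exact eq_of_left (h.eq 3 2)
  -- Block `(3, 4)` reads `X₃₄ + Z₄₂` and block `(3, 6)` reads `Z₄₂`; the repeated columns 4 and 6
  -- of `Z` allow the subtraction.
  · exact sub_eq_left (h.eq 3 4) (h.eq 3 6)
  · exact eq_of_left (h.eq 3 5)
  · exact eq_of_left (h.eq 4 2)
  · exact sub_eq_left (h.eq 4 3) (h.eq 6 3)
  · exact sub_eq_left (h.eq 4 4) (h.eq 6 4)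
  · exact eq_of_left (h.eq 4 5)
  · exact eq_of_left (h.eq 5 1)
  · exact eq_of_left (h.eq 5 2)
  · exact eq_of_left (h.eq 5 3)
  · exact eq_of_left (h.eq 5 4)
  · exact eq_of_left (h.eq 5 5)
  · intros
    rfl

theorem SolvesBlocks.yHat_eq (h : d.SolvesBlocks X Y Z) : d.yHat X Y = Y := by
  funext i j
  apply yHat.fun_cases_unfolding d X Y fun i j M => M = Y i j
  · exact sub_eq_middle (h.eq 6 6) (h.eq 6 4)
  · exact sub_eq_middle (h.eq 6 7) (h.eq 4 7)
  · exact eq_of_middle (h.eq 6 8)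
  · exact sub_add_eq_middle (h.eq 6 1) (h.eq 4 1)
  · exact eq_of_middle (h.eq 6 2)
  · exact sub_eq_middle (h.eq 7 6) (h.eq 7 4)
  · exact eq_of_middle (h.eq 7 8)
  · exact eq_of_middle (h.eq 7 2)
  · exact eq_of_middle (h.eq 8 6)
  · exact eq_of_middle (h.eq 8 7)
  · exact eq_of_middle (h.eq 8 8)
  · exact eq_of_middle (h.eq 8 1)
  · exact eq_of_middle (h.eq 8 2)
  · exact sub_add_eq_middle (h.eq 1 6) (h.eq 1 4)
  · exact eq_of_middle (h.eq 1 8)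
  · exact sub_left_eq_middle (h.eq 1 2)
  · exact eq_of_middle (h.eq 2 6)
  · exact eq_of_middle (h.eq 2 7)
  · exact eq_of_middle (h.eq 2 8)
  · exact sub_left_eq_middle (h.eq 2 1)
  · exact sub_left_eq_middle (h.eq 2 2)
  · intros
    rfl

theorem SolvesBlocks.zHat_eq (h : d.SolvesBlocks X Y Z) : d.zHat X Y Z = Z := by
  funext i j
  apply zHat.fun_cases_unfolding d X Y Z fun i j M => M = Z i j
  · exact eq_of_right (h.eq 9 9)
  · exact eq_of_right (h.eq 9 6)
  · exact eq_of_right (h.eq 9 7)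
  · exact eq_of_right (h.eq 9 3)
  · exact eq_of_right (h.eq 9 1)
  · exact eq_of_right (h.eq 6 9)
  · exact eq_of_right (h.eq 6 4)
  · exact eq_of_right (h.eq 4 7)
  · exact eq_of_right (h.eq 6 3)
  · exact sub_left_eq_right (h.eq 4 1)
  · exact eq_of_right (h.eq 7 9)
  · exact eq_of_right (h.eq 7 4)
  · exact sub_middle_eq_right (h.eq 7 7)
  · exact eq_of_right (h.eq 7 3)
  · exact sub_middle_eq_right (h.eq 7 1)
  · exact eq_of_right (h.eq 3 9)
  · exact eq_of_right (h.eq 3 6)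
  · exact eq_of_right (h.eq 3 7)
  · exact sub_left_eq_right (h.eq 3 3)
  · exact sub_left_eq_right (h.eq 3 1)
  · exact eq_of_right (h.eq 1 9)
  · exact sub_left_eq_right (h.eq 1 4)
  · exact sub_middle_eq_right (h.eq 1 7)
  · exact sub_left_eq_right (h.eq 1 3)
  · exact sub_sub_eq_right (h.eq 1 1)
  · intros
    rfl

/-- The solvability conditions on the blocks `A_{ij}`. -/
def Solvable (d : K.Decomposition) : Prop :=
  d.blk 9 4 = d.blk 9 6 ∧ d.blk 4 9 = d.blk 6 9 ∧ d.blk 6 4 = d.blk 4 6 ∧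
    K.rabcd_e_f_g = K.rbcd + K.re_f_g ∧
    (∀ i ∈ Finset.Icc 1 9, d.blk i 10 = 0) ∧
    (∀ j ∈ Finset.Icc 1 9, d.blk 10 j = 0) ∧
    d.blk 2 9 = 0 ∧ d.blk 9 2 = 0 ∧ d.blk 3 8 = 0 ∧ d.blk 8 3 = 0 ∧
    d.blk 4 8 = 0 ∧ d.blk 8 4 = 0 ∧ d.blk 5 6 = 0 ∧ d.blk 6 5 = 0 ∧
    d.blk 5 7 = 0 ∧ d.blk 7 5 = 0 ∧ d.blk 5 8 = 0 ∧ d.blk 8 5 = 0 ∧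
    d.blk 5 9 = 0 ∧ d.blk 9 5 = 0 ∧ d.blk 8 9 = 0 ∧ d.blk 9 8 = 0

theorem lhsBlocks_row_eq_zero (X : K.XBlocks) (Y : K.YBlocks) (Z : K.ZBlocks) {i j : ℕ}
    (hi : 10 ≤ i ∧ i ≤ 11) (hj : 1 ≤ j ∧ j ≤ 11) : lhsBlocks X Y Z i j = 0 := by
  obtain ⟨hj1, hj2⟩ := hj
  obtain rfl | rfl : i = 10 ∨ i = 11 := by omega
  all_goals
    -- The match on the column is outermost, so the row match reduces only once `j` is a numeral.
    interval_cases j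
    all_goals exact zero_eq rfl

theorem lhsBlocks_col_eq_zero (X : K.XBlocks) (Y : K.YBlocks) (Z : K.ZBlocks) {i j : ℕ}
    (hj : 10 ≤ j ∧ j ≤ 11) : lhsBlocks X Y Z i j = 0 := by
  obtain rfl | rfl : j = 10 ∨ j = 11 := by omega
  all_goals exact zero_eq rfl

theorem SolvesBlocks.solvable (h : d.SolvesBlocks X Y Z) : d.Solvable := by
  -- Block `(11, 11)` is `I_t` on the right and zero on the left.
  have ht : K.t = 0 := by
    have h0 := (h.eq 11 11).symm.trans (lhsBlocks_row_eq_zero X Y Z (by decide) (by decide))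
    rw [d.blk_last] at h0
    by_contra hne
    have hpos : 0 < K.t := Nat.pos_of_ne_zero hne
    have := congrFun (congrFun h0 ⟨0, hpos⟩) ⟨0, hpos⟩
    exact one_ne_zero (α := ℍ[ℝ]) ((Matrix.one_apply_eq _).symm.trans this)
  -- With truncated subtraction, `t = 0` gives only `≤`; the reverse inequality comes from the rank
  -- splitting in `exists_outer_form`.
  have hrank : K.rabcd_e_f_g = K.rbcd + K.re_f_g := by
    obtain ⟨_, _, P, Q, _, _, _, _, _, _, -, -, hA, -⟩ := K.exists_outer_form
    rw [t] at ht
    omega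
  refine ⟨(eq_of_right (h.eq 9 4)).trans (eq_of_right (h.eq 9 6)).symm,
    (eq_of_right (h.eq 4 9)).trans (eq_of_right (h.eq 6 9)).symm,
    (eq_of_right (h.eq 6 4)).trans (eq_of_right (h.eq 4 6)).symm, hrank, ?_, ?_,
    eq_zero_of_zero (h.eq 2 9), eq_zero_of_zero (h.eq 9 2), eq_zero_of_zero (h.eq 3 8),
    eq_zero_of_zero (h.eq 8 3), eq_zero_of_zero (h.eq 4 8), eq_zero_of_zero (h.eq 8 4),
    eq_zero_of_zero (h.eq 5 6), eq_zero_of_zero (h.eq 6 5), eq_zero_of_zero (h.eq 5 7),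
    eq_zero_of_zero (h.eq 7 5), eq_zero_of_zero (h.eq 5 8), eq_zero_of_zero (h.eq 8 5),
    eq_zero_of_zero (h.eq 5 9), eq_zero_of_zero (h.eq 9 5), eq_zero_of_zero (h.eq 8 9),
    eq_zero_of_zero (h.eq 9 8)⟩
  · intro i hi
    rw [Finset.mem_Icc] at hi
    rw [← h.eq i 10 ⟨hi.1, by omega⟩]
    exact lhsBlocks_col_eq_zero X Y Z (by decide)
  · intro j hj
    rw [Finset.mem_Icc] at hj
    rw [← h.eq 10 j (by decide) ⟨hj.1, by omega⟩]
    exact lhsBlocks_row_eq_zero X Y Z (by decide) ⟨hj.1, by omega⟩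

/-- The formulas of `yHat` and `zHat` involve `X` and `Y` only at positions that `xHat` and `yHat`
leave free, so the parameters are independent and the block equations hold identically, given the
conditions. -/
theorem Solvable.solvesBlocks (h : d.Solvable) (X : K.XBlocks) (Y : K.YBlocks) (Z : K.ZBlocks) :
    d.SolvesBlocks (d.xHat X) (d.yHat X Y) (d.zHat X Y Z) := by
  obtain ⟨h94, h49, h64, hr, hcol, hrow, h29, h92, h38, h83, h48, h84, h56, h65, h57, h75, h58, h85,
    h59, h95, h89, h98⟩ := h
  have ht : K.t = 0 := by
    rw [t, hr, Nat.sub_self]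
  intro i hi j hj
  by_cases hj10 : 9 ≤ j
  · rw [lhsBlocks_col_eq_zero _ _ _ (by omega)]
    obtain rfl | rfl : j = 9 ∨ j = 10 := by omega
    · obtain hi9 | rfl | rfl : i < 9 ∨ i = 9 ∨ i = 10 := by omega
      · exact (hcol (i + 1) (Finset.mem_Icc.2 (by omega))).symm
      · exact d.blk_ten_ten.symm
      · exact (d.blk_last_row 10 (by decide)).symm
    -- Block `(11, 11)` has size `t = 0`, so there is no entry to compare.
    · by_cases hi10 : i = 10
      · subst hi10
        ext1 x
        exact absurd (show 0 < K.t from x.pos) (by omega)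
      · exact (d.blk_last_col (i + 1) (by omega)).symm
  by_cases hi10 : 9 ≤ i
  · rw [lhsBlocks_row_eq_zero _ _ _ (by omega) (by omega)]
    obtain rfl | rfl : i = 9 ∨ i = 10 := by omega
    · exact (hrow (j + 1) (Finset.mem_Icc.2 (by omega))).symm
    · exact (d.blk_last_row (j + 1) (by omega)).symm
  replace hi : i < 9 := by omega
  replace hj : j < 9 := by omega
  interval_cases i
  · interval_cases j
    · exact right_sub_sub_eq
    · exact left_middle_sub_eq
    · exact left_right_sub_eq
    · exact left_right_sub_eq
    · exact left_eq
    · exact middle_right_shift_eq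
    · exact middle_right_sub_eq
    · exact middle_eq
    · exact right_eq rfl
  · interval_cases j
    · exact left_middle_sub_eq
    · exact left_middle_sub_eq
    · exact left_eq
    · exact left_eq
    · exact left_eq
    · exact middle_eq
    · exact middle_eq
    · exact middle_eq
    · exact zero_eq h29
  · interval_cases j
    · exact left_right_sub_eq
    · exact left_eq
    · exact left_right_sub_eq
    · exact left_sub_right_eq
    · exact left_eq
    · exact right_eq rfl
    · exact right_eq rfl
    · exact zero_eq h38
    · exact right_eq rfl
  · interval_cases j
    · exact left_right_sub_eq
    · exact left_eq
    · exact left_sub_right_eq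
    · exact left_sub_right_eq
    · exact left_eq
    -- Block `(4, 6)` is `Z₂₂`, which was set to `A₆₄`; the coincidence conditions enter at such
    -- places.
    · exact right_eq h64.symm
    · exact right_eq rfl
    · exact zero_eq h48
    · exact right_eq h49
  · interval_cases j
    · exact left_eq
    · exact left_eq
    · exact left_eq
    · exact left_eq
    · exact left_eq
    · exact zero_eq h56
    · exact zero_eq h57
    · exact zero_eq h58
    · exact zero_eq h59
  · interval_cases j
    · exact middle_right_shift_eq
    · exact middle_eq
    · exact right_eq rfl
    · exact right_eq rfl
    · exact zero_eq h65
    · exact middle_sub_right_eq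
    · exact middle_sub_right_eq
    · exact middle_eq
    · exact right_eq rfl
  · interval_cases j
    · exact middle_right_sub_eq
    · exact middle_eq
    · exact right_eq rfl
    · exact right_eq rfl
    · exact zero_eq h75
    · exact middle_sub_right_eq
    · exact middle_right_sub_eq
    · exact middle_eq
    · exact right_eq rfl
  · interval_cases j
    · exact middle_eq
    · exact middle_eq
    · exact zero_eq h83
    · exact zero_eq h84
    · exact zero_eq h85
    · exact middle_eq
    · exact middle_eq
    · exact middle_eq
    · exact zero_eq h89
  · interval_cases j
    · exact right_eq rfl
    · exact zero_eq h92
    · exact right_eq rfl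
    · exact right_eq h94
    · exact zero_eq h95
    · exact right_eq rfl
    · exact right_eq rfl
    · exact zero_eq h98
    · exact right_eq rfl

end QArray.Decomposition

theorem theorem3p4 {m n p₁ p₂ p₃ q₁ q₂ q₃ : ℕ} (K : QArray m n p₁ p₂ p₃ q₁ q₂ q₃) :
    -- the simultaneous decomposition exists
    Nonempty K.Decomposition ∧
    -- and for each such decomposition, with blocks `A_{ij} = d.blk i j`:
    ∀ d : K.Decomposition,
      -- solvability conditions
      ((∃ X Y Z, K.IsSolution X Y Z) ↔
        (d.blk 9 4 = d.blk 9 6 ∧ d.blk 4 9 = d.blk 6 9 ∧ d.blk 6 4 = d.blk 4 6 ∧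
          K.rabcd_e_f_g = K.rbcd + K.re_f_g ∧
          (∀ i ∈ Finset.Icc 1 9, d.blk i 10 = 0) ∧
          (∀ j ∈ Finset.Icc 1 9, d.blk 10 j = 0) ∧
          d.blk 2 9 = 0 ∧ d.blk 9 2 = 0 ∧ d.blk 3 8 = 0 ∧ d.blk 8 3 = 0 ∧
          d.blk 4 8 = 0 ∧ d.blk 8 4 = 0 ∧ d.blk 5 6 = 0 ∧ d.blk 6 5 = 0 ∧
          d.blk 5 7 = 0 ∧ d.blk 7 5 = 0 ∧ d.blk 5 8 = 0 ∧ d.blk 8 5 = 0 ∧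
          d.blk 5 9 = 0 ∧ d.blk 9 5 = 0 ∧ d.blk 8 9 = 0 ∧ d.blk 9 8 = 0)) ∧
      -- general solution in the consistent case
      ((∃ X Y Z, K.IsSolution X Y Z) → ∀ X Y Z,
        K.IsSolution X Y Z ↔
          ∃ (X' : K.XBlocks) (Y' : K.YBlocks) (Z' : K.ZBlocks),
            X = d.T₁.inv * blockMat 6 6 (d.xHat X') * d.V₁.inv ∧
            Y = d.T₂.inv * blockMat 6 6 (d.yHat X' Y') * d.V₂.inv ∧
            Z = d.T₃.inv * blockMat 6 6 (d.zHat X' Y' Z') * d.V₃.inv) := by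
  refine ⟨K.nonempty_decomposition, fun d => ⟨⟨?_, fun h => ?_⟩, ?_⟩⟩
  · rintro ⟨X, Y, Z, h⟩
    rw [QArray.Decomposition.eq_mul_blockMat_blocksOf d.T₁ d.V₁ X,
      QArray.Decomposition.eq_mul_blockMat_blocksOf d.T₂ d.V₂ Y,
      QArray.Decomposition.eq_mul_blockMat_blocksOf d.T₃ d.V₃ Z] at h
    exact (d.isSolution_iff_solvesBlocks.1 h).solvable
  -- Any parameters would do; all are taken to be zero.
  · exact ⟨_, _, _, d.isSolution_iff_solvesBlocks.2
      (QArray.Decomposition.Solvable.solvesBlocks h (fun _ _ => 0) (fun _ _ => 0) fun _ _ => 0)⟩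
  · rintro ⟨X₀, Y₀, Z₀, h₀⟩ X Y Z
    constructor
    · intro h
      have hX := QArray.Decomposition.eq_mul_blockMat_blocksOf d.T₁ d.V₁ X
      have hY := QArray.Decomposition.eq_mul_blockMat_blocksOf d.T₂ d.V₂ Y
      have hZ := QArray.Decomposition.eq_mul_blockMat_blocksOf d.T₃ d.V₃ Z
      rw [hX, hY, hZ] at h
      have hs := d.isSolution_iff_solvesBlocks.1 h
      refine ⟨blocksOf (d.T₁.val * X * d.V₁.val), blocksOf (d.T₂.val * Y * d.V₂.val),
        blocksOf (d.T₃.val * Z * d.V₃.val), ?_, ?_, ?_⟩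
      · rw [hs.xHat_eq]
        exact hX
      · rw [hs.yHat_eq]
        exact hY
      · rw [hs.zHat_eq]
        exact hZ
    · rintro ⟨X', Y', Z', rfl, rfl, rfl⟩
      -- The given solution is used only to obtain the solvability conditions, which do not depend
      -- on it.
      rw [QArray.Decomposition.eq_mul_blockMat_blocksOf d.T₁ d.V₁ X₀,
        QArray.Decomposition.eq_mul_blockMat_blocksOf d.T₂ d.V₂ Y₀,
        QArray.Decomposition.eq_mul_blockMat_blocksOf d.T₃ d.V₃ Z₀] at h₀
      exact d.isSolution_iff_solvesBlocks.2
        ((d.isSolution_iff_solvesBlocks.1 h₀).solvable.solvesBlocks X' Y' Z')
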